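/- **Setting (the algorithm).** Let $A\in\mathbb R^{m\times n}$ have every column of $\ell_1$-norm at most $t$ (with $t\ge 0$), let $x\in[0,1]^n$ and $0\le\delta<1$. Put $\gamma=1/(2n^{3/2})$ and $x^{(0)}=x$. For $k=0,1,2,\dots$, as long as $x^{(k)}$ is not in $\{0,1\}^n$, let $A_k$ be the set of alive variables $j$, i.e. those with $0<x^{(k)}_j<1$, and let $n_k=|A_k|$. Call row $i$ of $A$ big if $\sum_{j\in A_k}|a_{ij}|>t/(1-\delta)$, and let $W^{(k)}\subset\mathbb R^{A_k}$ be the span of the big rows restricted to $A_k$. Let $\delta_k=\delta$ if $\delta>0$ and $\delta_k=1/n_k$ if $\delta=0$. Choose a positive semidefinite matrix $U\in\mathbb R^{A_k\times A_k}$ (as a function of $k$ and $x^{(k)}$) with $w^TUw=0$ for all $w\in W^{(k)}$, $U_{jj}\le 1$ for all $j$, $\mathrm{Tr}(U)\ge \frac{\delta_k}{10}n_k$ and $U\preceq \frac{10}{9\delta_k}\,\mathrm{diag}(U)$. Draw independent uniform signs $r_k\in\{\pm1\}^{A_k}$ and set $x^{(k+1)}=x^{(k)}+\gamma_kU^{1/2}r_k$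 (the frozen variables being unchanged), where $\gamma_k$ is the largest number in $(0,\gamma]$ such that both $x^{(k)}\pm\gamma_kU^{1/2}r_k$ lie in the cube. When $x^{(k)}\in\{0,1\}^n$, stop and return $X=x^{(k)}$. For $\beta\ge1$, a random vector $X\in\{0,1\}^n$ with means $x_i=\mathbb E[X_i]$ is called $\beta$-concentrated if for all $a\in\mathbb R^n$ and $s\ge0$, with $M=\max_i|a_i|$ (and the right-hand side read as $1$ if its denominator vanishes), $$\Pr\big[a\cdot X-\mathbb E[a\cdot X]\ge s\big]\le\exp\left(-\frac{s^2/\beta}{2\left(\sum_i a_i^2(x_i-x_i^2)+Ms/3\right)}\right).$$ **Theorem.** There is an absolute constant $C>0$ such that for all $A$, $t$, $x$, $\delta$ as above a matrix $U$ as required exists in every iteration, and, whichever such matrices are chosen, the following holds. 1. With probability $1$ the algorithm stops, and its expected number of iterations is at most $Cn^4/\delta$ if $\delta>0$, and at most $Cn^4$ if $\delta=0$. 2. With probability $1$, $X\in\{0,1\}^n$ and $|A(X-x)|_\infty\le t/(1-\delta)$. 3. $\mathbb E[X_i]=x_i$ for every $i$. 4. If $\delta>0$, then $X$ is $(C/\delta)$-concentrated.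 -/

import Mathlib

open MeasureTheory ProbabilityTheory
open scoped Matrix MatrixOrder ENNReal

noncomputable section

namespace SubIsotropic

/-- The variables that are alive (still fractional) in the solution `x`. -/
abbrev Alive {n : ℕ} (x : Fin n → ℝ) : Type := {j : Fin n // 0 < x j ∧ x j < 1}

/-- All coordinates of `x` are `0` or `1`. -/
def IsIntegral {n : ℕ} (x : Fin n → ℝ) : Prop := ∀ j, x j = 0 ∨ x j = 1

/-- Row `i` of `A` is big at the current solution `x`: its `ℓ₁`-norm restricted to the alive
variables is strictly more than `t / (1 - δ)`. -/
def IsBig {m n : ℕ} (A : Matrix (Fin m) (Fin n) ℝ) (t δ : ℝ) (x : Fin n → ℝ) (i : Fin m) : Prop :=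
  t / (1 - δ) < ∑ j : Alive x, |A i j|

/-- The subspace chosen in an iteration with current solution `x`: the span of the big rows of `A`,
restricted to the alive variables. -/
def bigRowSpace {m n : ℕ} (A : Matrix (Fin m) (Fin n) ℝ) (t δ : ℝ) (x : Fin n → ℝ) :
    Submodule ℝ (Alive x → ℝ) :=
  Submodule.span ℝ {w | ∃ i, IsBig A t δ x i ∧ w = fun j : Alive x => A i j}

/-- `U` is a feasible covariance matrix for the subspace `W` and the parameters `a`, `η`:
it is positive semidefinite, `⟨wwᵀ, U⟩ = 0` for all `w ∈ W`, `U i i ≤ 1` for all `i`,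
`Tr U ≥ a N` (`N` being the number of coordinates), and `U ⪯ η diag(U)`. -/
structure IsFeasibleCov {ι : Type*} [Fintype ι] [DecidableEq ι] (W : Submodule ℝ (ι → ℝ))
    (a η : ℝ) (U : Matrix ι ι ℝ) : Prop where
  posSemidef : U.PosSemidef
  orthogonal : ∀ w ∈ W, w ⬝ᵥ (U *ᵥ w) = 0
  diag_le : ∀ i, U i i ≤ 1
  le_trace : a * (Fintype.card ι : ℝ) ≤ U.trace
  le_diag : (η • Matrix.diagonal (fun i => U i i) - U).PosSemidef

/-- The slack used in an iteration with `N` alive variables. For `δ > 0` it is `δ` itself. For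
`δ = 0` it is `1 / N`: there are then at most `N - 1` big rows, i.e. `(1 - 1 / N) N`. -/
def slack (δ : ℝ) (N : ℕ) : ℝ := if δ = 0 then 1 / (N : ℝ) else δ

/-- A rule that selects the covariance matrix in iteration `k` when the current solution is `x`. -/
abbrev CovRule (n : ℕ) : Type := (_k : ℕ) → (x : Fin n → ℝ) → Matrix (Alive x) (Alive x) ℝ

/-- The rule `U` always selects a feasible covariance matrix for the span of the big rows, with
`a = δ / 10` and `η = 10 / (9 δ)`, where `δ` is the slack. -/
def CovRule.IsValid {m n : ℕ} (U : CovRule n) (A : Matrix (Fin m) (Fin n) ℝ) (t δ : ℝ) : Prop :=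
  ∀ (k : ℕ) (x : Fin n → ℝ), x ∈ Set.Icc 0 1 →
    IsFeasibleCov (bigRowSpace A t δ x)
      (slack δ (Fintype.card (Alive x)) / 10) (10 / (9 * slack δ (Fintype.card (Alive x)))) (U k x)

/-- The direction `U^{1/2} r` on the alive coordinates of `x` (with the signs `r` restricted to
these coordinates), extended by `0` to the frozen coordinates. -/
def direction {n : ℕ} (x : Fin n → ℝ) (U : Matrix (Alive x) (Alive x) ℝ) (r : Fin n → ℝ) :
    Fin n → ℝ :=
  fun j => if h : 0 < x j ∧ x j < 1 then (CFC.sqrt U *ᵥ fun i : Alive x => r i) ⟨j, h⟩ else 0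

/-- The maximal step size `γ = 1 / (2 n^{3/2})`. -/
def maxStep (n : ℕ) : ℝ := 1 / (2 * (n : ℝ) ^ (3 / 2 : ℝ))

/-- The largest `s ∈ (0, γ]` such that both `x + s d` and `x - s d` lie in the cube `[0,1]^n`. -/
def stepSize {n : ℕ} (x d : Fin n → ℝ) : ℝ :=
  sSup {s | s ∈ Set.Ioc 0 (maxStep n) ∧ x + s • d ∈ Set.Icc 0 1 ∧ x - s • d ∈ Set.Icc 0 1}

/-- One iteration of the algorithm from `x`, with covariance matrix `U` and signs `r`. -/
def update {n : ℕ} (x : Fin n → ℝ) (U : Matrix (Alive x) (Alive x) ℝ) (r : Fin n → ℝ) :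
    Fin n → ℝ :=
  x + stepSize x (direction x U r) • direction x U r

/-- The solution `x^{(k)}` at the beginning of iteration `k`, started from `x`, when the signs
`r k` are used in iteration `k`. (It is constant once it is integral.) -/
def solution {n : ℕ} (U : CovRule n) (x : Fin n → ℝ) (r : ℕ → Fin n → ℝ) : ℕ → Fin n → ℝ
  | 0 => x
  | k + 1 => update (solution U x r k) (U k (solution U x r k)) (r k)

/-- The number of iterations until all variables are `0` or `1` (`⊤` if this never happens). -/
def iterations {n : ℕ} (U : CovRule n) (x : Fin n → ℝ) (r : ℕ → Fin n → ℝ) : ℕ∞ :=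
  ⨅ (k : ℕ) (_ : IsIntegral (solution U x r k)), (k : ℕ∞)

/-- The vector returned by the algorithm when it stops. -/
def output {n : ℕ} (U : CovRule n) (x : Fin n → ℝ) (r : ℕ → Fin n → ℝ) : Fin n → ℝ :=
  solution U x r (iterations U x r).toNat

/-- The `r k j` are independent, uniformly distributed random signs. -/
structure IsRandomSigns {Ω : Type*} [MeasurableSpace Ω] (P : Measure Ω) {n : ℕ}
    (r : ℕ → Fin n → Ω → ℝ) : Prop where
  measurable : ∀ k j, Measurable (r k j)
  eq_or_eq : ∀ k j ω, r k j ω = 1 ∨ r k j ω = -1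
  prob_one : ∀ k j, P {ω | r k j ω = 1} = 1 / 2
  indep : iIndepFun (fun (p : ℕ × Fin n) => r p.1 p.2) P

/-- `β`-concentration of the random vector `X` around its mean: Bernstein's inequality holds for
every linear function `∑ aⱼ Xⱼ` up to the factor `β ≥ 1` in the exponent. Here `‖a‖` is the sup
norm `maxⱼ |aⱼ|`. -/
def IsConcentrated {Ω : Type*} [MeasurableSpace Ω] (P : Measure Ω) {n : ℕ} (β : ℝ)
    (X : Ω → Fin n → ℝ) : Prop :=
  1 ≤ β ∧ ∀ (a : Fin n → ℝ) (s : ℝ), 0 ≤ s →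
    P.real {ω | s ≤ a ⬝ᵥ X ω - ∫ ω', a ⬝ᵥ X ω' ∂P} ≤
      Real.exp (-(s ^ 2 / β) /
        (2 * (∑ j, a j ^ 2 * ((∫ ω, X ω j ∂P) - (∫ ω, X ω j ∂P) ^ 2) + ‖a‖ * s / 3)))

end SubIsotropic

end

/-! Existence of `U` is convex duality. If no feasible `U` existed, a separating functional would be
given by a weight `lam ≥ 0` on the trace and a positive semidefinite `Q` paired with `η diag(U) -
U`. After scaling `Q` to have diagonal at most `1`, it has at most `N / η` eigenvalues above `η`, so
some subspace `F ⊥ W` of dimension at least `N - dim W - N / η` has `Q ≤ η diag(Q)` on it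
(`exists_subspace_le_diag`). The orthogonal projection onto `F` contradicts the separation
(`exists_isFeasibleCov`).

The rounding error is deterministic: a row does not move while it is big, and once it is not big its
alive entries have total size at most `t / (1 - δ)`, which bounds all later change
(`abs_row_error_le`). The marginals survive because opposite signs give opposite steps.

A step is shorter than `γ` only if a variable reaches the boundary for `r` or `-r`, so the
probability of a short step is at most twice the expected loss of alive variables
(`IsStepMatrix.avg_numAlive_le`). Hence `∑ xⱼ²` corrected by a multiple of the alive count grows
steadily in expectation, which bounds the running time.

For concentration one needs the variance of `b · step` bounded by the expected drop of a potential
that starts near `∑ aⱼ² xⱼ(1 - xⱼ)`. For full steps, `U ⪯ η diag(U)` gives this with `∑ aⱼ² (xⱼ -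
xⱼ²)` itself, but truncation depends on the signs and may spoil it. If short steps are rare, fourth
moments show that each coordinate keeps half its variance. If they are frequent, the alive count
falls quickly, and an added reserve term, jointly concave in the variable and the alive count, turns
this into a drop of the potential (`IsStepMatrix.avg_sq_le_avg_drop`). An exponential
supermartingale and Chernoff's bound finish the proof (`IsStepMatrix.avg_exp_le`,
`IsRandomSigns.isConcentrated_output`). -/

namespace SubIsotropic

/-! ### Spectral counting and a large subspace where `Q` is below its diagonal -/

/-- The quadratic form of a Hermitian matrix in its eigenbasis. -/
theorem dotProduct_mulVec_eq_sum_eigenvalues {ι : Type*} [Fintype ι] [DecidableEq ι]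
    {Q : Matrix ι ι ℝ} (hQ : Q.IsHermitian) (w : ι → ℝ) :
    w ⬝ᵥ Q *ᵥ w = ∑ k, hQ.eigenvalues k * ((hQ.eigenvectorBasis k).ofLp ⬝ᵥ w) ^ 2 := by
  have h := hQ.eigenvectorBasis.sum_inner_mul_inner (WithLp.toLp 2 w) (WithLp.toLp 2 (Q *ᵥ w))
  have e1 : inner ℝ (WithLp.toLp 2 w) (WithLp.toLp 2 (Q *ᵥ w)) = w ⬝ᵥ Q *ᵥ w := by
    simp [EuclideanSpace.inner_eq_star_dotProduct, dotProduct_comm]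
  rw [e1] at h
  rw [← h]
  refine Finset.sum_congr rfl fun k _ => ?_
  have e2 : inner ℝ (WithLp.toLp 2 w) (hQ.eigenvectorBasis k)
      = (hQ.eigenvectorBasis k).ofLp ⬝ᵥ w := by
    simp [EuclideanSpace.inner_eq_star_dotProduct]
  have e3 : inner ℝ (hQ.eigenvectorBasis k) (WithLp.toLp 2 (Q *ᵥ w))
      = hQ.eigenvalues k * ((hQ.eigenvectorBasis k).ofLp ⬝ᵥ w) := by
    have : inner ℝ (hQ.eigenvectorBasis k) (WithLp.toLp 2 (Q *ᵥ w))
      = (hQ.eigenvectorBasis k).ofLp ⬝ᵥ Q *ᵥ w := by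
      simp [EuclideanSpace.inner_eq_star_dotProduct, dotProduct_comm]
    rw [this, Matrix.dotProduct_mulVec, ← Matrix.mulVec_transpose]
    have ht : Qᵀ = Q := by simpa [Matrix.IsHermitian] using hQ
    rw [ht, hQ.mulVec_eigenvectorBasis, smul_dotProduct, smul_eq_mul]
  rw [e2, e3]; ring

theorem sum_sq_eigenvectorBasis {ι : Type*} [Fintype ι] [DecidableEq ι]
    {Q : Matrix ι ι ℝ} (hQ : Q.IsHermitian) (w : ι → ℝ) :
    ∑ k, ((hQ.eigenvectorBasis k).ofLp ⬝ᵥ w) ^ 2 = ∑ j, w j ^ 2 := by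
  have h := hQ.eigenvectorBasis.sum_inner_mul_inner (WithLp.toLp 2 w) (WithLp.toLp 2 w)
  have e1 : inner ℝ (WithLp.toLp 2 w) (WithLp.toLp 2 w) = ∑ j, w j ^ 2 := by
    rw [EuclideanSpace.inner_eq_star_dotProduct]
    simp [dotProduct, sq]
  rw [← e1, ← h]
  refine Finset.sum_congr rfl fun k _ => ?_
  have e2 : inner ℝ (WithLp.toLp 2 w) (hQ.eigenvectorBasis k)
      = (hQ.eigenvectorBasis k).ofLp ⬝ᵥ w := by
    simp [EuclideanSpace.inner_eq_star_dotProduct]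
  have e3 : inner ℝ (hQ.eigenvectorBasis k) (WithLp.toLp 2 w)
      = (hQ.eigenvectorBasis k).ofLp ⬝ᵥ w := by
    simp [EuclideanSpace.inner_eq_star_dotProduct, dotProduct_comm]
  rw [e2, e3]; ring

/-- A positive semidefinite matrix with diagonal at most `1` has at most `N / η` eigenvalues
above `η`. -/
theorem card_eigenvalues_gt_le {ι : Type*} [Fintype ι] [DecidableEq ι] {Q : Matrix ι ι ℝ}
    (hQ : Q.PosSemidef) (hd : ∀ j, Q j j ≤ 1) (η : ℝ) :
    (Fintype.card {k // η < hQ.1.eigenvalues k} : ℝ) * η ≤ Fintype.card ι := by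
  classical
  have h1 : Q.trace ≤ Fintype.card ι := by
    calc Q.trace = ∑ j, Q j j := rfl
      _ ≤ ∑ _j : ι, (1 : ℝ) := Finset.sum_le_sum fun j _ => hd j
      _ = Fintype.card ι := by simp
  have h2 : Q.trace = ∑ k, hQ.1.eigenvalues k := by
    simpa using hQ.1.trace_eq_sum_eigenvalues
  rw [h2] at h1
  refine le_trans ?_ h1
  rw [Fintype.card_subtype]
  calc ((Finset.univ.filter fun k => η < hQ.1.eigenvalues k).card : ℝ) * η
      = ∑ k ∈ Finset.univ.filter (fun k => η < hQ.1.eigenvalues k), η := by simp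
    _ ≤ ∑ k ∈ Finset.univ.filter (fun k => η < hQ.1.eigenvalues k), hQ.1.eigenvalues k :=
        Finset.sum_le_sum fun k hk => (Finset.mem_filter.1 hk).2.le
    _ ≤ ∑ k, hQ.1.eigenvalues k :=
        Finset.sum_le_sum_of_subset_of_nonneg (Finset.filter_subset _ _)
          fun k _ _ => hQ.eigenvalues_nonneg k

/-- A basis vector isotropic for `Q` lies in its kernel. This handles the zero diagonal entries,
where normalising the diagonal is impossible. -/
theorem PosSemidef.row_eq_zero {ι : Type*} [Fintype ι] [DecidableEq ι] {Q : Matrix ι ι ℝ}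
    (hQ : Q.PosSemidef) {i : ι} (hi : Q i i = 0) (j : ι) : Q i j = 0 ∧ Q j i = 0 := by
  have h := (hQ.dotProduct_mulVec_zero_iff (Pi.single i 1)).1 (by simp [hi])
  have h1 : Q j i = 0 := by simpa using congrFun h j
  have h2 : Q i j = Q j i := by simpa using hQ.1.apply j i
  exact ⟨h2.trans h1, h1⟩

/-- On a large subspace orthogonal to `W`, the form `Q` is at most `η diag(Q)`. -/
theorem exists_subspace_le_diag {ι : Type*} [Fintype ι] [DecidableEq ι] {Q : Matrix ι ι ℝ}
    (hQ : Q.PosSemidef) (W : Submodule ℝ (ι → ℝ)) {η : ℝ} (hη : 0 < η) :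
    ∃ F : Submodule ℝ (EuclideanSpace ℝ ι),
      (Fintype.card ι : ℝ) ≤ Module.finrank ℝ F + Module.finrank ℝ W + Fintype.card ι / η ∧
      ∀ v ∈ F, (∀ w ∈ W, w ⬝ᵥ v.ofLp = 0) ∧
        v.ofLp ⬝ᵥ Q *ᵥ v.ofLp ≤ η * ∑ j, Q j j * v j ^ 2 := by
  classical
  -- Since `0⁻¹ = 0`, the scaled matrix has diagonal entries `1`, or `0` where `Q` has a zero
  -- diagonal entry.
  set s : ι → ℝ := fun j => (√(Q j j))⁻¹ with hs
  have hdiag : ∀ j, 0 ≤ Q j j := fun j => hQ.diag_nonneg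
  set Q' : Matrix ι ι ℝ := Matrix.diagonal s * Q * Matrix.diagonal s with hQ'
  have hQ'psd : Q'.PosSemidef := by
    have := hQ.mul_mul_conjTranspose_same (Matrix.diagonal s)
    simpa [Matrix.diagonal_conjTranspose, hQ'] using this
  have hent : ∀ i j, Q' i j = s i * Q i j * s j := by
    intro i j; simp [hQ', Matrix.mul_diagonal, Matrix.diagonal_mul]
  have hd1 : ∀ j, Q' j j ≤ 1 := by
    intro j
    rw [hent]
    rcases (hdiag j).eq_or_lt with h | h
    · simp [← h]
    · have h1 : √(Q j j) * √(Q j j) = Q j j := Real.mul_self_sqrt h.le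
      have h2 : √(Q j j) ≠ 0 := (Real.sqrt_pos.2 h).ne'
      have : s j * Q j j * s j = 1 := by
        simp only [hs]; field_simp; rw [sq, h1]
      exact this.le
  set I := {k // η < hQ'psd.1.eigenvalues k}
  -- The kernel of `L` is the required subspace: orthogonality to `W`, and orthogonality of the
  -- rescaled vector to each eigenvector of `Q'` with eigenvalue above `η`.
  let L : EuclideanSpace ℝ ι →ₗ[ℝ] (Module.Dual ℝ W) × (I → ℝ) :=
    { toFun := fun v => (
        { toFun := fun w => (w : ι → ℝ) ⬝ᵥ v.ofLp
          map_add' := by intro a b; simp [add_dotProduct]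
          map_smul' := by intro a b; simp [smul_dotProduct] },
        fun k => (hQ'psd.1.eigenvectorBasis k).ofLp ⬝ᵥ fun j => √(Q j j) * v j)
      map_add' := by
        intro a b
        ext
        · simp [dotProduct_add]
        · simp [dotProduct, mul_add, Finset.sum_add_distrib]
      map_smul' := by
        intro c a
        ext
        · simp [dotProduct_smul]
        · simp [dotProduct, Finset.mul_sum, mul_left_comm] }
  refine ⟨LinearMap.ker L, ?_, ?_⟩
  · have h1 := L.finrank_range_add_finrank_ker
    have h2 : Module.finrank ℝ (LinearMap.range L) ≤ Module.finrank ℝ W + Fintype.card I := by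
      refine (Submodule.finrank_le _).trans ?_
      rw [Module.finrank_prod, Subspace.dual_finrank_eq, Module.finrank_fintype_fun_eq_card]
    rw [finrank_euclideanSpace] at h1
    have h3 := card_eigenvalues_gt_le hQ'psd hd1 η
    have h4 : (Fintype.card I : ℝ) ≤ Fintype.card ι / η := by
      rw [le_div_iff₀ hη]; exact h3
    have h5 : Fintype.card ι ≤ Module.finrank ℝ (LinearMap.ker L) + Module.finrank ℝ W
        + Fintype.card I := by omega
    have h6 : (Fintype.card ι : ℝ) ≤ Module.finrank ℝ (LinearMap.ker L) + Module.finrank ℝ W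
        + Fintype.card I := by exact_mod_cast h5
    linarith
  · intro v hv
    rw [LinearMap.mem_ker] at hv
    constructor
    · intro w hw
      have := congrArg (fun p => p.1 ⟨w, hw⟩) hv
      simpa [L] using this
    · have horth : ∀ k, η < hQ'psd.1.eigenvalues k →
          (hQ'psd.1.eigenvectorBasis k).ofLp ⬝ᵥ (fun j => √(Q j j) * v j) = 0 := by
        intro k hk
        have := congrArg (fun p => p.2 ⟨k, hk⟩) hv
        simpa [L] using this
      set w : ι → ℝ := fun j => √(Q j j) * v j with hw
      have e1 : v.ofLp ⬝ᵥ Q *ᵥ v.ofLp = w ⬝ᵥ Q' *ᵥ w := by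
        simp only [dotProduct, Matrix.mulVec, Finset.mul_sum]
        refine Finset.sum_congr rfl fun i _ => Finset.sum_congr rfl fun j _ => ?_
        rw [hent]
        by_cases hi : Q i i = 0
        · simp [(PosSemidef.row_eq_zero hQ hi j).1]
        by_cases hj : Q j j = 0
        · simp [(PosSemidef.row_eq_zero hQ hj i).2]
        have hi' : √(Q i i) ≠ 0 := (Real.sqrt_pos.2 ((hdiag i).lt_of_ne' hi)).ne'
        have hj' : √(Q j j) ≠ 0 := (Real.sqrt_pos.2 ((hdiag j).lt_of_ne' hj)).ne'
        simp only [hw, hs]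
        field_simp
      have e2 : ∑ j, Q j j * v j ^ 2 = ∑ j, w j ^ 2 := by
        refine Finset.sum_congr rfl fun j _ => ?_
        simp only [hw, mul_pow, Real.sq_sqrt (hdiag j)]
      rw [e1, e2, dotProduct_mulVec_eq_sum_eigenvalues hQ'psd.1,
        ← sum_sq_eigenvectorBasis hQ'psd.1, Finset.mul_sum]
      refine Finset.sum_le_sum fun k _ => ?_
      by_cases hk : η < hQ'psd.1.eigenvalues k
      · rw [horth k hk]; simp
      · exact mul_le_mul_of_nonneg_right (not_lt.1 hk) (sq_nonneg _)

/-! ### The positive semidefinite cone and existence of `U` by separation -/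

/-- The quadratic form `∑ᵢⱼ xᵢ Rᵢⱼ xⱼ`. -/
def quadForm {ι : Type*} [Fintype ι] (R : ι → ι → ℝ) (x : ι → ℝ) : ℝ :=
  ∑ i, ∑ j, x i * R i j * x j

theorem quadForm_eq {ι : Type*} [Fintype ι] (R : Matrix ι ι ℝ) (x : ι → ℝ) :
    quadForm R x = x ⬝ᵥ R *ᵥ x := by
  simp only [quadForm, dotProduct, Matrix.mulVec, Finset.mul_sum, mul_assoc]

theorem posSemidef_iff_quadForm {ι : Type*} [Fintype ι] (R : Matrix ι ι ℝ) :
    R.PosSemidef ↔ (∀ i j, R i j = R j i) ∧ ∀ x, 0 ≤ quadForm R x := by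
  rw [Matrix.posSemidef_iff_dotProduct_mulVec]
  simp only [quadForm_eq, star_trivial]
  refine and_congr_left' ⟨fun h i j => ?_, fun h => ?_⟩
  · simpa using h.apply j i
  · ext i j; simpa using h j i

theorem quadForm_add {ι : Type*} [Fintype ι] (R S : ι → ι → ℝ) (x : ι → ℝ) :
    quadForm (R + S) x = quadForm R x + quadForm S x := by
  simp [quadForm, mul_add, add_mul, Finset.sum_add_distrib]

theorem quadForm_smul {ι : Type*} [Fintype ι] (c : ℝ) (R : ι → ι → ℝ) (x : ι → ℝ) :
    quadForm (c • R) x = c * quadForm R x := by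
  simp only [quadForm, Pi.smul_apply, smul_eq_mul, Finset.mul_sum]
  exact Finset.sum_congr rfl fun i _ => Finset.sum_congr rfl fun j _ => by ring

theorem continuous_quadForm {ι : Type*} [Fintype ι] (x : ι → ℝ) :
    Continuous fun R : ι → ι → ℝ => quadForm R x := by
  unfold quadForm; fun_prop

/-- The cone of positive semidefinite matrices. -/
def psdSet (ι : Type*) [Fintype ι] : Set (ι → ι → ℝ) :=
  {R | (∀ i j, R i j = R j i) ∧ ∀ x, 0 ≤ quadForm R x}

theorem isClosed_psdSet (ι : Type*) [Fintype ι] : IsClosed (psdSet ι) := by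
  have : psdSet ι = (⋂ i, ⋂ j, {R | R i j = R j i}) ∩ ⋂ x, {R | 0 ≤ quadForm R x} := by
    ext R; simp [psdSet]
  rw [this]
  refine IsClosed.inter (isClosed_iInter fun i => isClosed_iInter fun j =>
    isClosed_eq (by fun_prop) (by fun_prop)) (isClosed_iInter fun x =>
    isClosed_le continuous_const (continuous_quadForm x))

theorem convex_psdSet (ι : Type*) [Fintype ι] : Convex ℝ (psdSet ι) := by
  intro R hR S hS a b ha hb _
  refine ⟨fun i j => by simp [hR.1 i j, hS.1 i j], fun x => ?_⟩
  rw [quadForm_add, quadForm_smul, quadForm_smul]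
  exact add_nonneg (mul_nonneg ha (hR.2 x)) (mul_nonneg hb (hS.2 x))

theorem smul_mem_psdSet {ι : Type*} [Fintype ι] {R : ι → ι → ℝ} (hR : R ∈ psdSet ι) {c : ℝ}
    (hc : 0 ≤ c) : c • R ∈ psdSet ι :=
  ⟨fun i j => by simp [hR.1 i j], fun x => by
    rw [quadForm_smul]; exact mul_nonneg hc (hR.2 x)⟩

/-- Testing the form on `eᵢ ± eⱼ` gives `2 |Rᵢⱼ| ≤ Rᵢᵢ + Rⱼⱼ`. This is the boundedness behind the
compactness needed for strict separation. -/
theorem abs_le_one_of_mem_psdSet {ι : Type*} [Fintype ι] [DecidableEq ι] {R : ι → ι → ℝ}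
    (hR : R ∈ psdSet ι) (hd : ∀ i, R i i ≤ 1) (i j : ι) : |R i j| ≤ 1 := by
  have key : ∀ c : ℝ, 0 ≤ R i i + c * R i j + (c * R j i + c * c * R j j) := by
    intro c
    have h := hR.2 (fun k => (Pi.single i 1 : ι → ℝ) k + c * (Pi.single j 1 : ι → ℝ) k)
    have : quadForm R (fun k => (Pi.single i 1 : ι → ℝ) k + c * (Pi.single j 1 : ι → ℝ) k)
        = R i i + c * R i j + (c * R j i + c * c * R j j) := by
      simp only [quadForm, add_mul, mul_add, Finset.sum_add_distrib]
      simp [Pi.single_apply, mul_assoc]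
      ring
    rwa [this] at h
  have h1 := key 1
  have h2 := key (-1)
  rw [hR.1 j i] at h1 h2
  have := hd i
  have := hd j
  rw [abs_le]; constructor <;> linarith

/-- The rank-one matrix `v vᵀ`. -/
def outer {ι : Type*} (v : ι → ℝ) : ι → ι → ℝ := fun i j => v i * v j

theorem quadForm_outer {ι : Type*} [Fintype ι] (v x : ι → ℝ) :
    quadForm (outer v) x = (x ⬝ᵥ v) ^ 2 := by
  simp only [quadForm, outer, dotProduct, sq, Finset.sum_mul, Finset.mul_sum]
  exact Finset.sum_congr rfl fun i _ => Finset.sum_congr rfl fun j _ => by ring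

theorem outer_mem_psdSet {ι : Type*} [Fintype ι] (v : ι → ℝ) : outer v ∈ psdSet ι :=
  ⟨fun i j => mul_comm _ _, fun x => by rw [quadForm_outer]; exact sq_nonneg _⟩

/-- A linear functional on matrices that is nonnegative on the cone of positive semidefinite
matrices is, on symmetric matrices, given by a positive semidefinite matrix. -/
theorem exists_posSemidef_of_nonneg {ι : Type*} [Fintype ι] [DecidableEq ι]
    (φ : (ι → ι → ℝ) →ₗ[ℝ] ℝ) (hφ : ∀ R ∈ psdSet ι, 0 ≤ φ R) :
    ∃ Q : Matrix ι ι ℝ, Q.PosSemidef ∧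
      ∀ R : ι → ι → ℝ, (∀ i j, R i j = R j i) → φ R = ∑ i, ∑ j, Q i j * R i j := by
  set e : ι → ι → (ι → ι → ℝ) := fun i j => Pi.single i (Pi.single j 1) with he
  have hrep : ∀ R, φ R = ∑ i, ∑ j, R i j * φ (e i j) := by
    intro R
    have : R = ∑ i, ∑ j, R i j • e i j := by
      ext a b
      simp only [Finset.sum_apply, Pi.smul_apply, smul_eq_mul, he, Pi.single_apply]
      rw [Finset.sum_eq_single a]
      · simp [Pi.single_apply]
      · intro i _ hi; simp [Ne.symm hi]
      · simp
    conv_lhs => rw [this]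
    simp
  have hsym : ∀ R : ι → ι → ℝ, (∀ i j, R i j = R j i) →
      φ R = ∑ i, ∑ j, (φ (e i j) + φ (e j i)) / 2 * R i j := by
    intro R hR
    have h2 : φ R = ∑ i, ∑ j, R i j * φ (e j i) := by
      rw [hrep, Finset.sum_comm]
      exact Finset.sum_congr rfl fun i _ => Finset.sum_congr rfl fun j _ => by rw [hR]
    have : φ R = (φ R + φ R) / 2 := by ring
    rw [this]
    nth_rw 1 [hrep R]
    rw [h2, ← Finset.sum_add_distrib, Finset.sum_div]
    refine Finset.sum_congr rfl fun i _ => ?_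
    rw [← Finset.sum_add_distrib, Finset.sum_div]
    exact Finset.sum_congr rfl fun j _ => by ring
  refine ⟨Matrix.of fun i j => (φ (e i j) + φ (e j i)) / 2, ?_, hsym⟩
  rw [posSemidef_iff_quadForm]
  refine ⟨fun i j => by simp [add_comm], fun x => ?_⟩
  -- Rank-one matrices suffice: the form of the symmetrised coefficient matrix at `x` is `φ (x xᵀ)`.
  have h := hφ _ (outer_mem_psdSet x)
  rw [hsym _ (outer_mem_psdSet x).1] at h
  refine h.trans_eq ?_
  simp only [quadForm, outer, Matrix.of_apply]
  exact Finset.sum_congr rfl fun i _ => Finset.sum_congr rfl fun j _ => by ring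

/-- The linear map `U ↦ η diag(U) - U`. -/
def diagGap {ι : Type*} [DecidableEq ι] (η : ℝ) : (ι → ι → ℝ) →ₗ[ℝ] (ι → ι → ℝ) where
  toFun U := fun i j => (if i = j then η * U i i else 0) - U i j
  map_add' U V := by
    ext i j
    by_cases h : i = j
    · simp [h]; ring
    · simp [h]; ring
  map_smul' c U := by
    ext i j
    by_cases h : i = j
    · simp [h]; ring
    · simp [h]

theorem diagGap_symm {ι : Type*} [DecidableEq ι] (η : ℝ) {U : ι → ι → ℝ}
    (hU : ∀ i j, U i j = U j i) (i j : ι) : diagGap η U i j = diagGap η U j i := by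
  simp only [diagGap, LinearMap.coe_mk, AddHom.coe_mk, hU i j]
  by_cases h : i = j
  · simp [h]
  · simp [h, Ne.symm h]

/-- Existence of a feasible covariance matrix, by convex duality. -/
theorem exists_isFeasibleCov {ι : Type*} [Fintype ι] [DecidableEq ι] (W : Submodule ℝ (ι → ℝ))
    {a η : ℝ} (hη : 0 < η)
    (h : Module.finrank ℝ W + a * Fintype.card ι + Fintype.card ι / η ≤ Fintype.card ι) :
    ∃ U : Matrix ι ι ℝ, IsFeasibleCov W a η U := by
  set K : Set (ι → ι → ℝ) :=
    psdSet ι ∩ ({U | ∀ w ∈ W, quadForm U w = 0} ∩ {U | ∀ i, U i i ≤ 1}) with hK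
  have hKclosed : IsClosed K := by
    refine (isClosed_psdSet ι).inter (IsClosed.inter ?_ ?_)
    · simp only [Set.ofPred_forall]
      exact isClosed_iInter fun w => isClosed_iInter fun _ =>
        isClosed_eq (continuous_quadForm w) continuous_const
    · simp only [Set.ofPred_forall]
      exact isClosed_iInter fun i => isClosed_le (by fun_prop) continuous_const
  have hKcompact : IsCompact K := by
    refine (isCompact_Icc (a := fun _ _ => (-1 : ℝ)) (b := fun _ _ => (1 : ℝ))).of_isClosed_subset
      hKclosed fun U hU => ?_
    have := fun i j => abs_le.1 (abs_le_one_of_mem_psdSet hU.1 hU.2.2 i j)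
    exact ⟨fun i j => (this i j).1, fun i j => (this i j).2⟩
  have hKconvex : Convex ℝ K := by
    refine (convex_psdSet ι).inter (Convex.inter ?_ ?_)
    · intro R hR S hS p q _ _ _ w hw
      rw [quadForm_add, quadForm_smul, quadForm_smul, hR w hw, hS w hw]; simp
    · intro R hR S hS p q hp hq hpq i
      have h1 := hR i
      have h2 := hS i
      simp only [Pi.add_apply, Pi.smul_apply, smul_eq_mul]
      nlinarith
  -- The conditions not built into `K` say that `T U` lies in `P`: large trace, and `η diag(U) - U`
  -- in the cone.
  let T : (ι → ι → ℝ) →ₗ[ℝ] ℝ × (ι → ι → ℝ) :=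
    LinearMap.prod
      { toFun := fun U => ∑ i, U i i
        map_add' := by intro U V; simp [Finset.sum_add_distrib]
        map_smul' := by intro r U; simp [Finset.mul_sum] } (diagGap η)
  have hT1 : ∀ U, (T U).1 = ∑ i, U i i := by intro U; simp [T]
  have hT2 : ∀ U, (T U).2 = diagGap η U := by intro U; simp [T]
  have hTcont : Continuous T := T.continuous_of_finiteDimensional
  set c : ℝ := a * Fintype.card ι with hc
  set P : Set (ℝ × (ι → ι → ℝ)) := Set.Ici c ×ˢ psdSet ι with hP
  by_contra hno
  push Not at hno
  have hdisj : Disjoint (T '' K) P := by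
    rw [Set.disjoint_left]
    rintro _ ⟨U, hU, rfl⟩ ⟨h1, h2⟩
    refine hno (Matrix.of U) ⟨(posSemidef_iff_quadForm _).2 hU.1, ?_, hU.2.2, ?_, ?_⟩
    · intro w hw
      rw [← quadForm_eq]; exact hU.2.1 w hw
    · rw [Set.mem_Ici, hT1] at h1
      exact h1
    · rw [hT2] at h2
      rw [posSemidef_iff_quadForm]
      have h3 : (η • Matrix.diagonal (fun i => Matrix.of U i i) - Matrix.of U)
          = Matrix.of (diagGap η U) := by
        ext i j
        by_cases h : i = j <;> simp [h, Matrix.diagonal, diagGap]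
      rw [h3]
      exact h2
  obtain ⟨f, u, v, hfK, huv, hfP⟩ := geometric_hahn_banach_compact_closed
    (hKconvex.linear_image T) (hKcompact.image hTcont)
    ((convex_Ici c).prod (convex_psdSet ι)) (isClosed_Ici.prod (isClosed_psdSet ι)) hdisj
  have h0 : (0 : ι → ι → ℝ) ∈ psdSet ι := by
    simpa using smul_mem_psdSet (outer_mem_psdSet (0 : ι → ℝ)) (le_refl (0 : ℝ))
  set lam : ℝ := f (1, 0) with hlam
  have hf1 : ∀ s : ℝ, f (s, 0) = s * lam := by
    intro s
    have : ((s, 0) : ℝ × (ι → ι → ℝ)) = s • (1, 0) := by simp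
    rw [this, map_smul, smul_eq_mul]
  let φ : (ι → ι → ℝ) →ₗ[ℝ] ℝ := f.toLinearMap.comp (LinearMap.inr ℝ ℝ (ι → ι → ℝ))
  have hφ : ∀ R, φ R = f (0, R) := fun R => rfl
  have hsplit : ∀ s R, f (s, R) = s * lam + φ R := by
    intro s R
    rw [← hf1, hφ, ← map_add]; simp
  have hlam0 : 0 ≤ lam := by
    by_contra hneg
    push Not at hneg
    -- If `lam` were negative, this far along the ray `f` would have fallen to `c * lam - |v - c *
    -- lam| ≤ v`. The same device on rays of the cone gives `0 ≤ φ`.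
    have h1 := hfP (c + |(v - c * lam)| / (-lam), 0)
      ⟨by simpa using div_nonneg (abs_nonneg _) (by linarith), h0⟩
    rw [hsplit, map_zero, add_zero, add_mul, div_mul_eq_mul_div, mul_div_assoc] at h1
    have : lam / -lam = -1 := by rw [div_neg, div_self hneg.ne]
    rw [this] at h1
    have := le_abs_self (v - c * lam)
    linarith [neg_abs_le (v - c * lam)]
  have hφ0 : ∀ R ∈ psdSet ι, 0 ≤ φ R := by
    intro R hR
    by_contra hneg
    push Not at hneg
    have h1 := hfP (c, (|(v - c * lam)| / (-φ R)) • R)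
      ⟨by simp, smul_mem_psdSet hR (div_nonneg (abs_nonneg _) (by linarith))⟩
    rw [hsplit, map_smul, smul_eq_mul, div_mul_eq_mul_div, mul_div_assoc] at h1
    have : φ R / -φ R = -1 := by rw [div_neg, div_self hneg.ne]
    rw [this] at h1
    linarith [neg_abs_le (v - c * lam)]
  obtain ⟨Q, hQ, hQφ⟩ := exists_posSemidef_of_nonneg φ hφ0
  obtain ⟨F, hF1, hF2⟩ := exists_subspace_le_diag hQ W hη
  -- The witness `U = ∑ gₖ gₖᵀ` is the orthogonal projection onto `F`: its trace is `dim F`, and its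
  -- diagonal is at most `1` by Bessel's inequality.
  set b := stdOrthonormalBasis ℝ F
  let g : Fin (Module.finrank ℝ F) → (ι → ℝ) := fun k => ((b k : F) : EuclideanSpace ℝ ι).ofLp
  have hgF : ∀ k, ((b k : F) : EuclideanSpace ℝ ι) ∈ F := fun k => (b k).2
  let U : ι → ι → ℝ := ∑ k, outer (g k)
  have hUij : ∀ i j, U i j = ∑ k, g k i * g k j := by
    intro i j; simp [U, outer, Finset.sum_apply]
  have hUquad : ∀ x, quadForm U x = ∑ k, (x ⬝ᵥ g k) ^ 2 := by
    intro x
    have : ∀ s : Finset (Fin (Module.finrank ℝ F)),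
        quadForm (∑ k ∈ s, outer (g k)) x = ∑ k ∈ s, (x ⬝ᵥ g k) ^ 2 := by
      intro s
      induction s using Finset.induction_on with
      | empty => simp [quadForm]
      | insert k s hk ih => rw [Finset.sum_insert hk, Finset.sum_insert hk, quadForm_add, ih,
          quadForm_outer]
    exact this _
  have hUpsd : U ∈ psdSet ι :=
    ⟨fun i j => by simp [hUij, mul_comm], fun x => by
      rw [hUquad]; exact Finset.sum_nonneg fun k _ => sq_nonneg _⟩
  have hUK : U ∈ K := by
    refine ⟨hUpsd, fun w hw => ?_, fun i => ?_⟩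
    · rw [hUquad]
      exact Finset.sum_eq_zero fun k _ => by rw [(hF2 _ (hgF k)).1 w hw]; simp
    · have horth : Orthonormal ℝ (fun k => ((b k : F) : EuclideanSpace ℝ ι)) :=
        b.orthonormal.comp_linearIsometry F.subtypeₗᵢ
      have h1 := horth.sum_inner_products_le (EuclideanSpace.single i (1 : ℝ)) (s := Finset.univ)
      simp only [EuclideanSpace.inner_single_right] at h1
      rw [hUij]
      simpa [sq, g] using h1
  have htr : ∑ i, U i i = Module.finrank ℝ F := by
    simp only [hUij]
    rw [Finset.sum_comm]
    have : ∀ k, ∑ i, g k i * g k i = 1 := by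
      intro k
      have h1 : ‖((b k : F) : EuclideanSpace ℝ ι)‖ = 1 := by
        exact b.orthonormal.1 k
      have h2 := EuclideanSpace.norm_sq_eq ((b k : F) : EuclideanSpace ℝ ι)
      rw [h1] at h2
      simp only [Real.norm_eq_abs, sq_abs] at h2
      rw [one_pow] at h2
      rw [h2]
      exact Finset.sum_congr rfl fun i _ => (sq _).symm
    simp [this]
  have hgap : 0 ≤ φ (diagGap η U) := by
    have : φ (diagGap η U) = ∑ k, φ (diagGap η (outer (g k))) := by simp [U]
    rw [this]
    refine Finset.sum_nonneg fun k _ => ?_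
    rw [hQφ _ (diagGap_symm η (outer_mem_psdSet (g k)).1)]
    have h1 := (hF2 _ (hgF k)).2
    have h2 : ∑ i, ∑ j, Q i j * diagGap η (outer (g k)) i j
        = η * ∑ j, Q j j * g k j ^ 2 - g k ⬝ᵥ Q *ᵥ g k := by
      rw [← quadForm_eq]
      simp only [diagGap, LinearMap.coe_mk, AddHom.coe_mk, outer, mul_sub, Finset.sum_sub_distrib,
        quadForm]
      congr 1
      · rw [Finset.mul_sum]
        refine Finset.sum_congr rfl fun i _ => ?_
        simp; ring
      · exact Finset.sum_congr rfl fun i _ => Finset.sum_congr rfl fun j _ => by ring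
    rw [h2]
    exact sub_nonneg.2 h1
  have h1 := hfK (T U) ⟨U, hUK, rfl⟩
  have h2 := hfP (c, 0) ⟨by simp, h0⟩
  have h3 : T U = ((T U).1, (T U).2) := rfl
  rw [h3, hT1, hT2, hsplit, htr] at h1
  rw [hsplit, map_zero, add_zero] at h2
  -- Then `f (T U) ≥ c * lam = f (c, 0)`, the reverse of the strict separation.
  have h4 : c ≤ Module.finrank ℝ F := by linarith
  nlinarith [mul_le_mul_of_nonneg_right h4 hlam0]

/-! ### Counting the big rows -/

theorem finrank_bigRowSpace_le {m n : ℕ} (A : Matrix (Fin m) (Fin n) ℝ) (t δ : ℝ)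
    (x : Fin n → ℝ) :
    Module.finrank ℝ (bigRowSpace A t δ x) ≤ Nat.card {i // IsBig A t δ x i} := by
  classical
  have : {w : Alive x → ℝ | ∃ i, IsBig A t δ x i ∧ w = fun j : Alive x => A i j}
      = Set.range fun (i : {i // IsBig A t δ x i}) (j : Alive x) => A i j := by
    ext w
    simp only [Set.mem_ofPred_eq, Set.mem_range, Subtype.exists]
    exact ⟨fun ⟨i, h, e⟩ => ⟨i, h, e.symm⟩, fun ⟨i, h, e⟩ => ⟨i, h, e.symm⟩⟩
  rw [bigRowSpace, this, Nat.card_eq_fintype_card]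
  exact finrank_range_le_card _

theorem slack_le_one {δ : ℝ} (hδ : δ < 1) {N : ℕ} (hN : 0 < N) : slack δ N ≤ 1 := by
  unfold slack
  split_ifs with h
  · rw [div_le_one (by exact_mod_cast hN)]
    exact_mod_cast hN
  · exact hδ.le

theorem slack_pos {δ : ℝ} (hδ : 0 ≤ δ) {N : ℕ} (hN : 0 < N) : 0 < slack δ N := by
  unfold slack
  split_ifs with h
  · positivity
  · exact hδ.lt_of_ne' h

/-- There are at most `(1 - slack) N` big rows. -/
theorem card_isBig_add_le {m n : ℕ} {A : Matrix (Fin m) (Fin n) ℝ} {t δ : ℝ}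
    (hA : ∀ j, ∑ i, |A i j| ≤ t) (hδ1 : δ < 1) (x : Fin n → ℝ)
    (hN : 0 < Fintype.card (Alive x)) :
    (Nat.card {i // IsBig A t δ x i} : ℝ) + slack δ (Fintype.card (Alive x)) *
      Fintype.card (Alive x) ≤ Fintype.card (Alive x) := by
  classical
  set N := Fintype.card (Alive x)
  rw [Nat.card_eq_fintype_card, Fintype.card_subtype]
  set B := Finset.univ.filter fun i => IsBig A t δ x i with hB
  have hN' : (0 : ℝ) < N := by exact_mod_cast hN
  rcases B.eq_empty_or_nonempty with h | h
  · rw [h]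
    simp only [Finset.card_empty, Nat.cast_zero, zero_add]
    exact mul_le_of_le_one_left hN'.le (slack_le_one hδ1 hN)
  · have h1 : (B.card : ℝ) * (t / (1 - δ)) < N * t := by
      calc (B.card : ℝ) * (t / (1 - δ)) = ∑ _i ∈ B, t / (1 - δ) := by simp
        _ < ∑ i ∈ B, ∑ j : Alive x, |A i j| :=
            Finset.sum_lt_sum_of_nonempty h fun i hi => (Finset.mem_filter.1 hi).2
        _ ≤ ∑ i, ∑ j : Alive x, |A i j| :=
            Finset.sum_le_sum_of_subset_of_nonneg (Finset.subset_univ _)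
              fun i _ _ => Finset.sum_nonneg fun j _ => abs_nonneg _
        _ = ∑ j : Alive x, ∑ i, |A i j| := Finset.sum_comm
        _ ≤ ∑ _j : Alive x, t := Finset.sum_le_sum fun j _ => hA j
        _ = N * t := by simp [N]
    have hd : 0 < 1 - δ := by linarith
    rw [← mul_div_assoc, div_lt_iff₀ hd] at h1
    have ht : 0 < t := by
      obtain ⟨i, hi⟩ := h
      obtain ⟨j⟩ : Nonempty (Alive x) := Fintype.card_pos_iff.1 hN
      have h0 : 0 ≤ t := (Finset.sum_nonneg fun i _ => abs_nonneg (A i j)).trans (hA j)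
      refine h0.lt_of_ne fun h => ?_
      rw [← h] at h1
      simp at h1
    have h2 : (B.card : ℝ) < N * (1 - δ) := by
      by_contra hc
      push Not at hc
      nlinarith
    unfold slack
    split_ifs with h0
    -- For `δ = 0` the strict inequality between integers gains a whole unit, which is exactly
    -- `slack * N`.
    · rw [h0, sub_zero, mul_one] at h2
      have h3 : B.card + 1 ≤ N := by exact_mod_cast h2
      have h4 : (B.card : ℝ) + 1 ≤ N := by exact_mod_cast h3
      rwa [one_div, inv_mul_cancel₀ hN'.ne']
    · linarith

/-- A feasible covariance matrix exists in every iteration. -/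
theorem exists_isValid {m n : ℕ} {A : Matrix (Fin m) (Fin n) ℝ} {t δ : ℝ}
    (hA : ∀ j, ∑ i, |A i j| ≤ t) (hδ : 0 ≤ δ) (hδ1 : δ < 1) :
    ∃ U : CovRule n, U.IsValid A t δ := by
  have key : ∀ x : Fin n → ℝ, ∃ U : Matrix (Alive x) (Alive x) ℝ,
      IsFeasibleCov (bigRowSpace A t δ x)
      (slack δ (Fintype.card (Alive x)) / 10) (10 / (9 * slack δ (Fintype.card (Alive x)))) U := by
    intro x
    rcases (Fintype.card (Alive x)).eq_zero_or_pos with h0 | hN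
    -- Here `slack` may be `1 / 0 = 0`, so `exists_isFeasibleCov` does not apply; all conditions are
    -- trivial.
    · have : IsEmpty (Alive x) := Fintype.card_eq_zero_iff.1 h0
      refine ⟨0, Matrix.PosSemidef.zero, fun w _ => by simp, fun i => isEmptyElim i, ?_, ?_⟩
      · simp
      · convert Matrix.PosSemidef.zero using 1
        exact Subsingleton.elim _ _
    · have hs := slack_pos hδ hN
      refine exists_isFeasibleCov _ (by positivity) ?_
      have h1 := card_isBig_add_le hA hδ1 x hN
      have h2 : (Module.finrank ℝ (bigRowSpace A t δ x) : ℝ)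
          ≤ Nat.card {i // IsBig A t δ x i} := by
        exact_mod_cast finrank_bigRowSpace_le A t δ x
      -- The room `slack * N` left by the big rows is split: one tenth for the trace, nine tenths
      -- for the discarded eigenvectors.
      have h3 : (Fintype.card (Alive x) : ℝ) / (10 / (9 * slack δ (Fintype.card (Alive x))))
          = 9 / 10 * (slack δ (Fintype.card (Alive x)) * Fintype.card (Alive x)) := by
        field_simp
      rw [h3]
      linarith
  choose U hU using key
  exact ⟨fun _ x => U x, fun _ x _ => hU x⟩

/-! ### The step matrix on all coordinates -/

/-- The square root of the covariance matrix, extended by zero to all variables. -/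
noncomputable def stepMatrix {n : ℕ} (x : Fin n → ℝ) (U : Matrix (Alive x) (Alive x) ℝ) :
    Matrix (Fin n) (Fin n) ℝ := fun j i =>
  if hj : 0 < x j ∧ x j < 1 then
    if hi : 0 < x i ∧ x i < 1 then CFC.sqrt U ⟨j, hj⟩ ⟨i, hi⟩ else 0
  else 0

theorem sum_alive {n : ℕ} (x : Fin n → ℝ) (f : Alive x → ℝ) :
    ∑ i : Alive x, f i = ∑ i, if h : 0 < x i ∧ x i < 1 then f ⟨i, h⟩ else 0 := by
  rw [← Fintype.sum_subtype_add_sum_subtype (fun i => 0 < x i ∧ x i < 1)]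
  have h1 : ∀ i : {i // ¬ (0 < x i ∧ x i < 1)},
      (if h : 0 < x i ∧ x i < 1 then f ⟨i, h⟩ else 0) = 0 := fun i => dif_neg i.2
  have h2 : ∀ i : Alive x, (if h : 0 < x i ∧ x i < 1 then f ⟨i, h⟩ else 0) = f i :=
    fun i => dif_pos i.2
  simp only [h1, h2, Finset.sum_const_zero, add_zero]

theorem direction_eq {n : ℕ} (x : Fin n → ℝ) (U : Matrix (Alive x) (Alive x) ℝ) (r : Fin n → ℝ) :
    direction x U r = stepMatrix x U *ᵥ r := by
  ext j
  simp only [direction, Matrix.mulVec, dotProduct, stepMatrix]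
  split_ifs with h
  · rw [sum_alive]
    refine Finset.sum_congr rfl fun i _ => ?_
    split_ifs <;> simp
  · simp

theorem sqrt_symm {ι : Type*} [Fintype ι] [DecidableEq ι] (U : Matrix ι ι ℝ) (i j : ι) :
    CFC.sqrt U i j = CFC.sqrt U j i := by
  have := (Matrix.nonneg_iff_posSemidef.1 (CFC.sqrt_nonneg U)).1
  simpa using this.apply j i

/-- By symmetry of the root, the left side is `‖U^{1/2} v‖²`. All conditions on `U` pass to the
entries of `U^{1/2}` through this identity. -/
theorem sum_sqrt_sq {ι : Type*} [Fintype ι] [DecidableEq ι] {U : Matrix ι ι ℝ}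
    (hU : U.PosSemidef) (v : ι → ℝ) :
    ∑ i, (∑ j, v j * CFC.sqrt U j i) ^ 2 = v ⬝ᵥ U *ᵥ v := by
  have h := CFC.sqrt_mul_sqrt_self U (Matrix.nonneg_iff_posSemidef.2 hU)
  set S := CFC.sqrt U with hS
  have hv : v ᵥ* S = S *ᵥ v := by
    rw [← Matrix.mulVec_transpose]
    congr 1
    ext i j
    exact sqrt_symm U j i
  conv_rhs => rw [← h, ← Matrix.mulVec_mulVec, Matrix.dotProduct_mulVec]
  rw [← hv]
  simp [dotProduct, Matrix.vecMul, sq]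

theorem sum_sqrt_row_sq {ι : Type*} [Fintype ι] [DecidableEq ι] {U : Matrix ι ι ℝ}
    (hU : U.PosSemidef) (j : ι) : ∑ i, CFC.sqrt U j i ^ 2 = U j j := by
  have := sum_sqrt_sq hU (Pi.single j 1)
  simpa [Pi.single_apply] using this

/-- The properties of the matrix `S` used in a step `x ↦ x ± g S r`. -/
structure IsStepMatrix {n : ℕ} (x : Fin n → ℝ) (c η : ℝ) (S : Matrix (Fin n) (Fin n) ℝ) :
    Prop where
  row_eq_zero : ∀ j, ¬ (0 < x j ∧ x j < 1) → ∀ i, S j i = 0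
  row_le : ∀ j, ∑ i, S j i ^ 2 ≤ 1
  le_trace : c ≤ ∑ j, ∑ i, S j i ^ 2
  le_diag : ∀ v : Fin n → ℝ,
    ∑ i, (∑ j, v j * S j i) ^ 2 ≤ η * ∑ j, v j ^ 2 * ∑ i, S j i ^ 2

theorem stepMatrix_row_sq {n : ℕ} (x : Fin n → ℝ) {U : Matrix (Alive x) (Alive x) ℝ}
    (hU : U.PosSemidef) (j : Fin n) :
    ∑ i, stepMatrix x U j i ^ 2 = if h : 0 < x j ∧ x j < 1 then U ⟨j, h⟩ ⟨j, h⟩ else 0 := by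
  split_ifs with h
  · rw [← sum_sqrt_row_sq hU, sum_alive]
    refine Finset.sum_congr rfl fun i _ => ?_
    simp only [stepMatrix, h]
    split_ifs <;> simp_all
  · exact Finset.sum_eq_zero fun i _ => by simp [stepMatrix, h]

theorem sum_stepMatrix_sq {n : ℕ} (x : Fin n → ℝ) {U : Matrix (Alive x) (Alive x) ℝ}
    (hU : U.PosSemidef) (v : Fin n → ℝ) :
    ∑ i, (∑ j, v j * stepMatrix x U j i) ^ 2
      = (fun j : Alive x => v j) ⬝ᵥ U *ᵥ fun j : Alive x => v j := by
  rw [← sum_sqrt_sq hU, sum_alive]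
  refine Finset.sum_congr rfl fun i _ => ?_
  split_ifs with hi
  · rw [sum_alive]
    congr 1
    refine Finset.sum_congr rfl fun j _ => ?_
    simp only [stepMatrix, hi]
    split_ifs <;> simp_all
  · have : ∑ j, v j * stepMatrix x U j i = 0 :=
      Finset.sum_eq_zero fun j _ => by simp [stepMatrix, hi]
    rw [this]; simp

/-- The probabilistic analysis of a step uses only these properties; orthogonality to `W` is needed
separately, for the rounding error. -/
theorem IsFeasibleCov.isStepMatrix {n : ℕ} {x : Fin n → ℝ} {W : Submodule ℝ (Alive x → ℝ)}
    {a η : ℝ} {U : Matrix (Alive x) (Alive x) ℝ} (hU : IsFeasibleCov W a η U) :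
    IsStepMatrix x (a * Fintype.card (Alive x)) η (stepMatrix x U) := by
  refine ⟨fun j hj i => by simp only [stepMatrix, hj, dite_false], fun j => ?_, ?_, fun v => ?_⟩
  · rw [stepMatrix_row_sq x hU.posSemidef]
    split_ifs with h
    · exact hU.diag_le _
    · exact zero_le_one
  · simp only [stepMatrix_row_sq x hU.posSemidef]
    rw [← sum_alive x fun j => U j j]
    exact hU.le_trace
  · rw [sum_stepMatrix_sq x hU.posSemidef]
    have h := ((posSemidef_iff_quadForm _).1 hU.le_diag).2 fun j : Alive x => v j
    rw [quadForm_eq, Matrix.sub_mulVec, dotProduct_sub] at h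
    refine (sub_nonneg.1 h).trans_eq ?_
    simp only [stepMatrix_row_sq x hU.posSemidef]
    rw [Matrix.smul_mulVec, dotProduct_smul, smul_eq_mul]
    congr 1
    simp only [dotProduct, Matrix.mulVec_diagonal]
    rw [sum_alive]
    refine Finset.sum_congr rfl fun j _ => ?_
    split_ifs
    · ring
    · simp

/-- Big rows are orthogonal to the direction of the step. -/
theorem IsFeasibleCov.sum_mul_stepMatrix {n : ℕ} {x : Fin n → ℝ} {W : Submodule ℝ (Alive x → ℝ)}
    {a η : ℝ} {U : Matrix (Alive x) (Alive x) ℝ} (hU : IsFeasibleCov W a η U) (w : Fin n → ℝ)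
    (hw : (fun j : Alive x => w j) ∈ W) (i : Fin n) : ∑ j, w j * stepMatrix x U j i = 0 := by
  have h := sum_stepMatrix_sq x hU.posSemidef w
  rw [hU.orthogonal _ hw] at h
  have := (Finset.sum_eq_zero_iff_of_nonneg fun i _ => sq_nonneg _).1 h i (Finset.mem_univ i)
  exact pow_eq_zero_iff two_ne_zero |>.1 this

/-! ### Averages over sign patterns -/

/-- The sign vector encoded by a Boolean vector. -/
def signs {n : ℕ} (ε : Fin n → Bool) : Fin n → ℝ := fun j => if ε j then 1 else -1

/-- The average of `F` over all sign patterns. -/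
noncomputable def avg {n : ℕ} (F : (Fin n → Bool) → ℝ) : ℝ := (2 ^ n)⁻¹ * ∑ ε, F ε

theorem avg_add {n : ℕ} (F G : (Fin n → Bool) → ℝ) :
    avg (fun ε => F ε + G ε) = avg F + avg G := by
  simp [avg, Finset.sum_add_distrib, mul_add]

theorem avg_sub {n : ℕ} (F G : (Fin n → Bool) → ℝ) :
    avg (fun ε => F ε - G ε) = avg F - avg G := by
  simp [avg, Finset.sum_sub_distrib, mul_sub]

theorem avg_const_mul {n : ℕ} (c : ℝ) (F : (Fin n → Bool) → ℝ) :
    avg (fun ε => c * F ε) = c * avg F := by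
  simp only [avg, ← Finset.mul_sum]; ring

theorem avg_const {n : ℕ} (c : ℝ) : avg (fun _ : Fin n → Bool => c) = c := by
  simp [avg]

theorem avg_sum {n : ℕ} {ι : Type*} (s : Finset ι) (F : ι → (Fin n → Bool) → ℝ) :
    avg (fun ε => ∑ i ∈ s, F i ε) = ∑ i ∈ s, avg (F i) := by
  simp only [avg]
  rw [Finset.sum_comm, Finset.mul_sum]

theorem avg_mono {n : ℕ} {F G : (Fin n → Bool) → ℝ} (h : ∀ ε, F ε ≤ G ε) : avg F ≤ avg G :=
  mul_le_mul_of_nonneg_left (Finset.sum_le_sum fun ε _ => h ε) (by positivity)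

theorem avg_nonneg {n : ℕ} {F : (Fin n → Bool) → ℝ} (h : ∀ ε, 0 ≤ F ε) : 0 ≤ avg F :=
  mul_nonneg (by positivity) (Finset.sum_nonneg fun ε _ => h ε)

theorem avg_not {n : ℕ} (F : (Fin n → Bool) → ℝ) :
    avg (fun ε => F fun j => !ε j) = avg F := by
  unfold avg
  congr 1
  exact Equiv.sum_comp (Function.Involutive.toPerm (fun (ε : Fin n → Bool) j => !ε j)
    fun ε => by simp) F

theorem signs_not {n : ℕ} (ε : Fin n → Bool) : signs (fun j => !ε j) = -signs ε := by
  ext j; cases h : ε j <;> simp [signs, h]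

theorem signs_mul_self {n : ℕ} (ε : Fin n → Bool) (j : Fin n) : signs ε j * signs ε j = 1 := by
  cases h : ε j <;> simp [signs, h]

theorem avg_flip {n : ℕ} (a : Fin n) (F : (Fin n → Bool) → ℝ) :
    avg (fun ε => F (Function.update ε a (!ε a))) = avg F := by
  unfold avg
  congr 1
  exact Equiv.sum_comp (Function.Involutive.toPerm
    (fun (ε : Fin n → Bool) => Function.update ε a (!ε a)) fun ε => by simp) F

theorem signs_flip_self {n : ℕ} (ε : Fin n → Bool) (a : Fin n) :
    signs (Function.update ε a (!ε a)) a = -signs ε a := by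
  cases h : ε a <;> simp [signs, h]

theorem sum_signs_flip {n : ℕ} (c : Fin n → ℝ) {s : Finset (Fin n)} {a : Fin n} (ha : a ∉ s)
    (ε : Fin n → Bool) :
    ∑ i ∈ s, c i * signs (Function.update ε a (!ε a)) i = ∑ i ∈ s, c i * signs ε i := by
  refine Finset.sum_congr rfl fun i hi => ?_
  have : i ≠ a := fun h => ha (h ▸ hi)
  simp [signs, this]

/-- Induction on `s`: averaging over a flip of the new sign removes the cross term. -/
theorem avg_sum_sq_finset {n : ℕ} (c : Fin n → ℝ) (s : Finset (Fin n)) :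
    avg (fun ε => (∑ i ∈ s, c i * signs ε i) ^ 2) = ∑ i ∈ s, c i ^ 2 := by
  induction s using Finset.induction_on with
  | empty => simp [avg]
  | insert a s ha ih =>
    set F : (Fin n → Bool) → ℝ := fun ε => (∑ i ∈ insert a s, c i * signs ε i) ^ 2 with hF
    have h1 : avg F + avg F = avg (fun ε => 2 * (∑ i ∈ s, c i * signs ε i) ^ 2 + 2 * c a ^ 2) := by
      nth_rw 2 [← avg_flip a F]
      rw [← avg_add]
      congr 1
      ext ε
      simp only [hF, Finset.sum_insert ha, sum_signs_flip c ha, signs_flip_self]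
      linear_combination (2 * c a ^ 2) * signs_mul_self ε a
    rw [avg_add, avg_const_mul, avg_const, ih] at h1
    rw [Finset.sum_insert ha]
    linarith

/-- Flipping the new sign leaves `y⁴ + 6 c² y² + c⁴`, and `3 σ⁴ + 6 c² σ² + c⁴ ≤ 3 (σ² + c²)²`. -/
theorem avg_sum_pow_four_finset {n : ℕ} (c : Fin n → ℝ) (s : Finset (Fin n)) :
    avg (fun ε => (∑ i ∈ s, c i * signs ε i) ^ 4) ≤ 3 * (∑ i ∈ s, c i ^ 2) ^ 2 := by
  induction s using Finset.induction_on with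
  | empty => simp [avg]
  | insert a s ha ih =>
    set F : (Fin n → Bool) → ℝ := fun ε => (∑ i ∈ insert a s, c i * signs ε i) ^ 4 with hF
    have h1 : avg F + avg F = avg (fun ε => 2 * (∑ i ∈ s, c i * signs ε i) ^ 4
        + (12 * c a ^ 2 * (∑ i ∈ s, c i * signs ε i) ^ 2 + 2 * c a ^ 4)) := by
      nth_rw 2 [← avg_flip a F]
      rw [← avg_add]
      congr 1
      ext ε
      simp only [hF, Finset.sum_insert ha, sum_signs_flip c ha, signs_flip_self]
      linear_combination (12 * c a ^ 2 * (∑ i ∈ s, c i * signs ε i) ^ 2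
        + 2 * c a ^ 4 * (signs ε a * signs ε a + 1)) * signs_mul_self ε a
    rw [avg_add, avg_add, avg_const_mul, avg_const_mul, avg_const, avg_sum_sq_finset] at h1
    rw [Finset.sum_insert ha]
    nlinarith [sq_nonneg (c a ^ 2)]

theorem avg_dotProduct_sq {n : ℕ} (c : Fin n → ℝ) :
    avg (fun ε => (c ⬝ᵥ signs ε) ^ 2) = ∑ i, c i ^ 2 := avg_sum_sq_finset c Finset.univ

theorem avg_dotProduct_pow_four {n : ℕ} (c : Fin n → ℝ) :
    avg (fun ε => (c ⬝ᵥ signs ε) ^ 4) ≤ 3 * (∑ i, c i ^ 2) ^ 2 :=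
  avg_sum_pow_four_finset c Finset.univ

theorem avg_dotProduct_mulVec_sq {n : ℕ} (b : Fin n → ℝ) (S : Matrix (Fin n) (Fin n) ℝ) :
    avg (fun ε => (b ⬝ᵥ S *ᵥ signs ε) ^ 2) = ∑ i, (∑ j, b j * S j i) ^ 2 := by
  simp only [Matrix.dotProduct_mulVec]
  rw [avg_dotProduct_sq]
  simp [Matrix.vecMul, dotProduct]

/-- Cauchy–Schwarz. With `γ² = 1 / (4 n³)`, it keeps every coordinate of a step within `1 / (2 n)`.
-/
theorem sq_mulVec_signs_le {n : ℕ} (S : Matrix (Fin n) (Fin n) ℝ) (hS : ∀ j, ∑ i, S j i ^ 2 ≤ 1)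
    (ε : Fin n → Bool) (j : Fin n) : (S *ᵥ signs ε) j ^ 2 ≤ n := by
  have h := Finset.sum_mul_sq_le_sq_mul_sq Finset.univ (fun i => S j i) (signs ε)
  have h1 : ∑ i, signs ε i ^ 2 = n := by simp [sq, signs_mul_self]
  rw [h1] at h
  refine h.trans ?_
  exact mul_le_of_le_one_left (Nat.cast_nonneg n) (hS j)

/-! ### The step size -/

theorem maxStep_sq (n : ℕ) : maxStep n ^ 2 = 1 / (4 * (n : ℝ) ^ 3) := by
  have h : ((n : ℝ) ^ (3 / 2 : ℝ)) ^ 2 = (n : ℝ) ^ 3 := by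
    rw [← Real.rpow_natCast, ← Real.rpow_mul (Nat.cast_nonneg n)]
    norm_num
  rw [maxStep, div_pow, mul_pow, h]; norm_num

theorem maxStep_nonneg (n : ℕ) : 0 ≤ maxStep n := by unfold maxStep; positivity

theorem maxStep_pos {n : ℕ} (hn : 0 < n) : 0 < maxStep n := by
  unfold maxStep
  have : (0 : ℝ) < n := by exact_mod_cast hn
  positivity

/-- The distance of `xⱼ` to the boundary of `[0, 1]`. -/
noncomputable def gap {n : ℕ} (x : Fin n → ℝ) (j : Fin n) : ℝ := min (x j) (1 - x j)

theorem mem_cube_iff {n : ℕ} (x v : Fin n → ℝ) :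
    (x + v ∈ Set.Icc (0 : Fin n → ℝ) 1 ∧ x - v ∈ Set.Icc (0 : Fin n → ℝ) 1) ↔
      ∀ j, |v j| ≤ gap x j := by
  simp only [Set.mem_Icc, Pi.le_def, Pi.add_apply, Pi.sub_apply, Pi.zero_apply, Pi.one_apply,
    gap, le_min_iff, abs_le]
  constructor
  · rintro ⟨⟨h1, h2⟩, h3, h4⟩ j
    have := h1 j; have := h2 j; have := h3 j; have := h4 j
    exact ⟨⟨by linarith, by linarith⟩, by linarith, by linarith⟩
  · intro h
    exact ⟨⟨fun j => by linarith [(h j).1.1], fun j => by linarith [(h j).2.2]⟩,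
      fun j => by linarith [(h j).1.2], fun j => by linarith [(h j).2.1]⟩

theorem stepSize_eq {n : ℕ} (x d : Fin n → ℝ) :
    stepSize x d = sSup {s | s ∈ Set.Ioc 0 (maxStep n) ∧ ∀ j, |s * d j| ≤ gap x j} := by
  unfold stepSize
  congr 1
  ext s
  have := mem_cube_iff x (s • d)
  simp only [Pi.smul_apply, smul_eq_mul] at this
  rw [Set.mem_ofPred_eq, Set.mem_ofPred_eq, this]

theorem stepSize_neg {n : ℕ} (x d : Fin n → ℝ) : stepSize x (-d) = stepSize x d := by
  simp only [stepSize_eq, Pi.neg_apply, mul_neg, abs_neg]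

theorem gap_pos {n : ℕ} {x : Fin n → ℝ} {j : Fin n} (h : 0 < x j ∧ x j < 1) : 0 < gap x j :=
  lt_min h.1 (by linarith [h.2])

theorem gap_nonneg {n : ℕ} {x : Fin n → ℝ} (hx : x ∈ Set.Icc (0 : Fin n → ℝ) 1) (j : Fin n) :
    0 ≤ gap x j := le_min (hx.1 j) (sub_nonneg.2 (hx.2 j))

theorem eventually_mul_lt {n : ℕ} {x d : Fin n → ℝ} {s : ℝ}
    (h : ∀ j, d j ≠ 0 → |s * d j| < gap x j) (hx : x ∈ Set.Icc (0 : Fin n → ℝ) 1) :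
    ∀ᶠ u in nhds s, ∀ j, |u * d j| ≤ gap x j := by
  rw [Filter.eventually_all]
  intro j
  by_cases hd : d j = 0
  · simp [hd, gap_nonneg hx j]
  · have hc : ContinuousAt (fun u : ℝ => |u * d j|) s := by fun_prop
    exact (hc.eventually_lt_const (h j hd)).mono fun u hu => hu.le

/-- The supremum is attained: the constraints are closed, and small positive steps are admissible
because alive variables have positive gap and frozen ones do not move. -/
theorem stepSize_mem {n : ℕ} (hn : 0 < n) {x d : Fin n → ℝ} (hx : x ∈ Set.Icc (0 : Fin n → ℝ) 1)
    (hd : ∀ j, ¬ (0 < x j ∧ x j < 1) → d j = 0) :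
    stepSize x d ∈ {s | s ∈ Set.Ioc 0 (maxStep n) ∧ ∀ j, |s * d j| ≤ gap x j} := by
  set T := {s | s ∈ Set.Ioc 0 (maxStep n) ∧ ∀ j, |s * d j| ≤ gap x j} with hT
  obtain ⟨s0, hs0⟩ : T.Nonempty := by
    have h := eventually_mul_lt (x := x) (d := d) (s := 0) (fun j hj => by
      have : 0 < x j ∧ x j < 1 := by
        by_contra hc; exact hj (hd j hc)
      simpa using gap_pos this) hx
    have h1 : ∀ᶠ u in nhdsWithin (0 : ℝ) (Set.Ioi 0), u ∈ Set.Ioc 0 (maxStep n) :=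
      Ioc_mem_nhdsGT (maxStep_pos hn)
    obtain ⟨u, hu1, hu2⟩ := (h1.and (h.filter_mono nhdsWithin_le_nhds)).exists
    exact ⟨u, hu1, hu2⟩
  have hbdd : BddAbove T := ⟨maxStep n, fun s hs => hs.1.2⟩
  have hle : s0 ≤ sSup T := le_csSup hbdd hs0
  have hcl : IsClosed {s : ℝ | s ≤ maxStep n ∧ ∀ j, |s * d j| ≤ gap x j} := by
    refine IsClosed.and ?_ ?_
    · exact isClosed_le continuous_id continuous_const
    · simp only [Set.ofPred_forall]
      exact isClosed_iInter fun j => isClosed_le (by fun_prop) continuous_const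
  have hmem := closure_minimal (s := T)
    (t := {s : ℝ | s ≤ maxStep n ∧ ∀ j, |s * d j| ≤ gap x j}) (fun s hs => ⟨hs.1.2, hs.2⟩) hcl
    (csSup_mem_closure ⟨s0, hs0⟩ hbdd)
  rw [stepSize_eq]
  exact ⟨⟨hs0.1.1.trans_le hle, hmem.1⟩, hmem.2⟩

theorem stepSize_nonneg {n : ℕ} (x d : Fin n → ℝ) : 0 ≤ stepSize x d :=
  Real.sSup_nonneg fun _ hs => hs.1.1.le

theorem stepSize_le {n : ℕ} (x d : Fin n → ℝ) : stepSize x d ≤ maxStep n :=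
  Real.sSup_le (fun _ hs => hs.1.2) (maxStep_nonneg n)

theorem abs_stepSize_mul_le {n : ℕ} {x d : Fin n → ℝ} (hx : x ∈ Set.Icc (0 : Fin n → ℝ) 1)
    (hd : ∀ j, ¬ (0 < x j ∧ x j < 1) → d j = 0) (j : Fin n) :
    |stepSize x d * d j| ≤ gap x j := (stepSize_mem j.pos hx hd).2 j

/-- A step shorter than the maximal one is stopped by some variable hitting the boundary. -/
theorem exists_eq_gap_of_stepSize_lt {n : ℕ} {x d : Fin n → ℝ}
    (hx : x ∈ Set.Icc (0 : Fin n → ℝ) 1) (hd : ∀ j, ¬ (0 < x j ∧ x j < 1) → d j = 0)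
    (h : stepSize x d < maxStep n) :
    ∃ j, (0 < x j ∧ x j < 1) ∧ |stepSize x d * d j| = gap x j := by
  have hn : 0 < n := by
    rcases n.eq_zero_or_pos with rfl | hn
    · exact absurd (stepSize_nonneg x d) (not_le.2 (h.trans_le (by simp [maxStep])))
    · exact hn
  by_contra hc
  push Not at hc
  have hmem := stepSize_mem hn hx hd
  have hlt : ∀ j, d j ≠ 0 → |stepSize x d * d j| < gap x j := fun j hj => by
    have : 0 < x j ∧ x j < 1 := by
      by_contra hc; exact hj (hd j hc)
    exact lt_of_le_of_ne (hmem.2 j) (hc j this)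
  -- If no moving variable is tight, a slightly longer step is still admissible, against maximality.
  have h1 := (eventually_mul_lt hlt hx).filter_mono
    (nhdsWithin_le_nhds (s := Set.Ioi (stepSize x d)))
  have h2 : ∀ᶠ u in nhdsWithin (stepSize x d) (Set.Ioi (stepSize x d)),
      u ∈ Set.Ioc (stepSize x d) (maxStep n) := Ioc_mem_nhdsGT h
  obtain ⟨u, hu1, hu2⟩ := (h1.and h2).exists
  have hmem' : u ∈ {s | s ∈ Set.Ioc 0 (maxStep n) ∧ ∀ j, |s * d j| ≤ gap x j} :=
    ⟨⟨hmem.1.1.trans hu2.1, hu2.2⟩, hu1⟩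
  have h3 := le_csSup ⟨maxStep n, fun s hs => hs.1.2⟩ hmem'
  rw [← stepSize_eq] at h3
  exact absurd hu2.1 (not_lt.2 h3)

/-! ### The number of alive variables -/

/-- The number of alive variables. -/
noncomputable def numAlive {n : ℕ} (x : Fin n → ℝ) : ℝ := Fintype.card (Alive x)

theorem numAlive_eq {n : ℕ} (x : Fin n → ℝ) :
    numAlive x = ∑ j, if 0 < x j ∧ x j < 1 then (1 : ℝ) else 0 := by
  simp [numAlive, Fintype.card_subtype]

theorem numAlive_nonneg {n : ℕ} (x : Fin n → ℝ) : 0 ≤ numAlive x := Nat.cast_nonneg _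

theorem numAlive_le {n : ℕ} (x : Fin n → ℝ) : numAlive x ≤ n := by
  have := Fintype.card_subtype_le fun j => 0 < x j ∧ x j < 1
  rw [Fintype.card_fin] at this
  exact Nat.cast_le.2 this

theorem alive_of_alive_add {n : ℕ} {x v : Fin n → ℝ} (hv : ∀ j, |v j| ≤ gap x j) {j : Fin n} (h : 0 < (x + v) j ∧ (x + v) j < 1) :
    0 < x j ∧ x j < 1 := by
  by_contra hc
  have h0 : gap x j ≤ 0 := by
    by_contra hg
    push Not at hg
    have := lt_min_iff.1 hg
    exact hc ⟨this.1, by linarith [this.2]⟩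
  have h1 : v j = 0 := abs_eq_zero.1 (le_antisymm ((hv j).trans h0) (abs_nonneg _))
  simp only [Pi.add_apply, h1, add_zero] at h
  exact hc h

theorem numAlive_add_le {n : ℕ} {x v : Fin n → ℝ} (hv : ∀ j, |v j| ≤ gap x j) : numAlive (x + v) ≤ numAlive x := by
  rw [numAlive_eq, numAlive_eq]
  refine Finset.sum_le_sum fun j _ => ?_
  by_cases h : 0 < (x + v) j ∧ (x + v) j < 1
  · rw [if_pos h, if_pos (alive_of_alive_add hv h)]
  · rw [if_neg h]; split_ifs <;> norm_num

/-- The tight variable `i` reaches the boundary in at least one of `x + v` and `x - v`, and no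
frozen variable revives. -/
theorem numAlive_add_sub_le {n : ℕ} {x v : Fin n → ℝ} (hv : ∀ j, |v j| ≤ gap x j) {i : Fin n} (hi : 0 < x i ∧ x i < 1) (hvi : |v i| = gap x i) :
    numAlive (x + v) + numAlive (x - v) + 1 ≤ 2 * numAlive x := by
  have hv' : ∀ j, |(-v) j| ≤ gap x j := fun j => by simpa using hv j
  rw [sub_eq_add_neg]
  have h1 : ∑ j, (if j = i then (1 : ℝ) else 0) = 1 := by simp
  suffices h : numAlive (x + v) + numAlive (x + -v) + ∑ j, (if j = i then (1 : ℝ) else 0)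
      ≤ 2 * numAlive x by rwa [h1] at h
  simp only [numAlive_eq]
  rw [← Finset.sum_add_distrib, ← Finset.sum_add_distrib, Finset.mul_sum]
  refine Finset.sum_le_sum fun j _ => ?_
  have hp : (0 < (x + v) j ∧ (x + v) j < 1) → 0 < x j ∧ x j < 1 := alive_of_alive_add hv
  have hm : (0 < (x + -v) j ∧ (x + -v) j < 1) → 0 < x j ∧ x j < 1 := alive_of_alive_add hv'
  by_cases hj : j = i
  · subst hj
    have : ¬ ((0 < (x + v) j ∧ (x + v) j < 1) ∧ (0 < (x + -v) j ∧ (x + -v) j < 1)) := by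
      simp only [Pi.add_apply, Pi.neg_apply, gap] at hvi ⊢
      rintro ⟨⟨h1, h2⟩, h3, h4⟩
      rcases min_choice (x j) (1 - x j) with h | h <;> rw [h] at hvi <;>
        rcases abs_choice (v j) with h' | h' <;> rw [h'] at hvi <;> linarith
    rw [if_pos hi, if_pos rfl]
    by_cases h1 : 0 < (x + v) j ∧ (x + v) j < 1
    · rw [if_pos h1, if_neg fun h2 => this ⟨h1, h2⟩]; norm_num
    · rw [if_neg h1]; split_ifs <;> norm_num
  · rw [if_neg hj]
    by_cases h1 : 0 < x j ∧ x j < 1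
    · rw [if_pos h1]; split_ifs <;> norm_num
    · rw [if_neg h1, if_neg fun h => h1 (hp h), if_neg fun h => h1 (hm h)]; norm_num

/-! ### One step: short steps, energy and variance -/

/-- The increment of the solution when the signs `ε` are used with the matrix `S`. -/
noncomputable def step {n : ℕ} (x : Fin n → ℝ) (S : Matrix (Fin n) (Fin n) ℝ)
    (ε : Fin n → Bool) : Fin n → ℝ :=
  stepSize x (S *ᵥ signs ε) • (S *ᵥ signs ε)

/-- The indicator that the step is shorter than the maximal one. -/
noncomputable def short {n : ℕ} (x : Fin n → ℝ) (S : Matrix (Fin n) (Fin n) ℝ)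
    (ε : Fin n → Bool) : ℝ :=
  if stepSize x (S *ᵥ signs ε) < maxStep n then 1 else 0

theorem update_eq {n : ℕ} (x : Fin n → ℝ) (U : Matrix (Alive x) (Alive x) ℝ) (ε : Fin n → Bool) :
    update x U (signs ε) = x + step x (stepMatrix x U) ε := by
  rw [update, direction_eq]; rfl

theorem step_not {n : ℕ} (x : Fin n → ℝ) (S : Matrix (Fin n) (Fin n) ℝ) (ε : Fin n → Bool) :
    step x S (fun j => !ε j) = -step x S ε := by
  unfold step
  rw [signs_not, Matrix.mulVec_neg, stepSize_neg, smul_neg]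

theorem short_nonneg {n : ℕ} (x : Fin n → ℝ) (S : Matrix (Fin n) (Fin n) ℝ) (ε : Fin n → Bool) :
    0 ≤ short x S ε := by
  unfold short; split_ifs <;> norm_num

theorem short_le_one {n : ℕ} (x : Fin n → ℝ) (S : Matrix (Fin n) (Fin n) ℝ) (ε : Fin n → Bool) :
    short x S ε ≤ 1 := by
  unfold short; split_ifs <;> norm_num

/-- Opposite signs give opposite steps, because the step size is symmetric in the direction. This
gives the martingale property. -/
theorem avg_dotProduct_step {n : ℕ} (x : Fin n → ℝ) (S : Matrix (Fin n) (Fin n) ℝ)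
    (b : Fin n → ℝ) : avg (fun ε => b ⬝ᵥ step x S ε) = 0 := by
  have h := avg_not fun ε => b ⬝ᵥ step x S ε
  simp only [step_not, dotProduct_neg] at h
  have h2 := avg_const_mul (-1) fun ε => b ⬝ᵥ step x S ε
  simp only [neg_mul, one_mul] at h2
  linarith

section

variable {n : ℕ} {x : Fin n → ℝ} {c η : ℝ} {S : Matrix (Fin n) (Fin n) ℝ}

theorem IsStepMatrix.mulVec_eq_zero (hS : IsStepMatrix x c η S) (r : Fin n → ℝ) (j : Fin n)
    (hj : ¬ (0 < x j ∧ x j < 1)) : (S *ᵥ r) j = 0 :=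
  show ∑ i, S j i * r i = 0 from Finset.sum_eq_zero fun i _ => by rw [hS.row_eq_zero j hj i, zero_mul]

theorem IsStepMatrix.abs_step_le (hS : IsStepMatrix x c η S)
    (hx : x ∈ Set.Icc (0 : Fin n → ℝ) 1) (ε : Fin n → Bool) (j : Fin n) :
    |step x S ε j| ≤ gap x j :=
  abs_stepSize_mul_le hx (fun j hj => hS.mulVec_eq_zero _ j hj) j

theorem IsStepMatrix.add_step_mem (hS : IsStepMatrix x c η S)
    (hx : x ∈ Set.Icc (0 : Fin n → ℝ) 1) (ε : Fin n → Bool) :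
    x + step x S ε ∈ Set.Icc (0 : Fin n → ℝ) 1 :=
  ((mem_cube_iff x _).2 (hS.abs_step_le hx ε)).1

theorem step_sq_le_maxStep (x : Fin n → ℝ) (S : Matrix (Fin n) (Fin n) ℝ) (ε : Fin n → Bool)
    (j : Fin n) : step x S ε j ^ 2 ≤ maxStep n ^ 2 * (S *ᵥ signs ε) j ^ 2 := by
  simp only [step, Pi.smul_apply, smul_eq_mul, mul_pow]
  exact mul_le_mul_of_nonneg_right
    (pow_le_pow_left₀ (stepSize_nonneg _ _) (stepSize_le _ _) 2) (sq_nonneg _)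

theorem le_step_sq (x : Fin n → ℝ) (S : Matrix (Fin n) (Fin n) ℝ) (ε : Fin n → Bool)
    (j : Fin n) : maxStep n ^ 2 * (S *ᵥ signs ε) j ^ 2
      - maxStep n ^ 2 * (short x S ε * (S *ᵥ signs ε) j ^ 2) ≤ step x S ε j ^ 2 := by
  unfold short
  split_ifs with h
  · nlinarith [sq_nonneg (step x S ε j)]
  · have : stepSize x (S *ᵥ signs ε) = maxStep n := le_antisymm (stepSize_le _ _) (not_lt.1 h)
    simp only [step, Pi.smul_apply, smul_eq_mul, mul_pow, this]
    linarith

theorem IsStepMatrix.step_sq_le (hS : IsStepMatrix x c η S) (ε : Fin n → Bool) (j : Fin n) :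
    step x S ε j ^ 2 ≤ 1 / (4 * (n : ℝ) ^ 2) := by
  have hn : (0 : ℝ) < n := by exact_mod_cast j.pos
  refine (step_sq_le_maxStep x S ε j).trans ?_
  refine (mul_le_mul_of_nonneg_left (sq_mulVec_signs_le S hS.row_le ε j) (sq_nonneg _)).trans_eq ?_
  rw [maxStep_sq]; field_simp

theorem IsStepMatrix.abs_step_le_div (hS : IsStepMatrix x c η S) (ε : Fin n → Bool) (j : Fin n) :
    |step x S ε j| ≤ 1 / (2 * (n : ℝ)) := by
  have hn : (0 : ℝ) < n := by exact_mod_cast j.pos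
  refine abs_le_of_sq_le_sq ((hS.step_sq_le ε j).trans_eq ?_) (by positivity)
  field_simp; norm_num

/-- Pairing `ε` with its negation, a short step costs the pair at least one alive variable. -/
theorem IsStepMatrix.avg_numAlive_le (hS : IsStepMatrix x c η S)
    (hx : x ∈ Set.Icc (0 : Fin n → ℝ) 1) :
    avg (short x S) ≤ 2 * (numAlive x - avg fun ε => numAlive (x + step x S ε)) := by
  have key : ∀ ε, short x S ε ≤ 2 * numAlive x
      - (numAlive (x + step x S ε) + numAlive (x + step x S fun j => !ε j)) := by
    intro ε
    have hv := hS.abs_step_le hx ε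
    have hv' : ∀ j, |(-step x S ε) j| ≤ gap x j := fun j => by simpa using hv j
    rw [step_not]
    unfold short
    split_ifs with h
    · obtain ⟨j, hj, hj'⟩ := exists_eq_gap_of_stepSize_lt hx
        (fun j hj => hS.mulVec_eq_zero _ j hj) h
      have := numAlive_add_sub_le hv hj hj'
      rw [sub_eq_add_neg] at this
      linarith
    · linarith [numAlive_add_le hv, numAlive_add_le hv']
  have h := avg_mono key
  rw [avg_sub, avg_const, avg_add, avg_not fun ε => numAlive (x + step x S ε)] at h
  linarith

/-- The potential for the running time. -/
noncomputable def energy (x : Fin n → ℝ) : ℝ := ∑ j, x j ^ 2 - numAlive x / (2 * n)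

/-- Full steps would add `γ² Tr U` to `∑ xⱼ²`. A short one forfeits at most `γ² n² = 1 / (4 n)`, so
the expected loss is covered by the `numAlive / (2 n)` term. -/
theorem IsStepMatrix.avg_energy_ge (hS : IsStepMatrix x c η S)
    (hx : x ∈ Set.Icc (0 : Fin n → ℝ) 1) :
    energy x + maxStep n ^ 2 * c ≤ avg fun ε => energy (x + step x S ε) := by
  have h1 : avg (fun ε => energy (x + step x S ε)) = ∑ j, x j ^ 2
      + (avg fun ε => ∑ j, step x S ε j ^ 2)
      - 1 / (2 * n) * avg fun ε => numAlive (x + step x S ε) := by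
    rw [← avg_const_mul, ← avg_const (n := n) (∑ j, x j ^ 2)]
    have h0 := avg_dotProduct_step x S ((2 : ℝ) • x)
    rw [← add_zero (avg _ + avg _), ← h0, ← avg_add, ← avg_add, ← avg_sub]
    congr 1
    ext ε
    simp only [energy, Pi.add_apply, add_sq, Finset.sum_add_distrib, dotProduct, Pi.smul_apply,
      smul_eq_mul]
    ring
  have h2 : maxStep n ^ 2 * (∑ j, ∑ i, S j i ^ 2) - 1 / (4 * n) * avg (short x S)
      ≤ avg fun ε => ∑ j, step x S ε j ^ 2 := by
    have key : ∀ ε, maxStep n ^ 2 * (∑ j, (S j ⬝ᵥ signs ε) ^ 2) - 1 / (4 * n) * short x S ε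
        ≤ ∑ j, step x S ε j ^ 2 := by
      intro ε
      have h3 := Finset.sum_le_sum fun j (_ : j ∈ Finset.univ) => le_step_sq x S ε j
      rw [Finset.sum_sub_distrib, ← Finset.mul_sum, ← Finset.mul_sum, ← Finset.mul_sum] at h3
      refine le_trans (sub_le_sub_left ?_ _) h3
      have h4 : ∑ j, (S *ᵥ signs ε) j ^ 2 ≤ (n : ℝ) ^ 2 := by
        refine (Finset.sum_le_sum fun j _ => sq_mulVec_signs_le S hS.row_le ε j).trans_eq ?_
        simp [sq]
      have h5 : maxStep n ^ 2 * (short x S ε * ∑ j, (S *ᵥ signs ε) j ^ 2)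
          ≤ maxStep n ^ 2 * (short x S ε * (n : ℝ) ^ 2) :=
        mul_le_mul_of_nonneg_left (mul_le_mul_of_nonneg_left h4 (short_nonneg x S ε))
          (sq_nonneg _)
      refine h5.trans_eq ?_
      rw [maxStep_sq]
      rcases n.eq_zero_or_pos with rfl | hn
      · simp
      · have : (0 : ℝ) < n := by exact_mod_cast hn
        field_simp
    have h6 := avg_mono key
    rw [avg_sub, avg_const_mul, avg_const_mul, avg_sum] at h6
    simpa only [avg_dotProduct_sq] using h6
  have h3 := hS.avg_numAlive_le hx
  have h4 := mul_le_mul_of_nonneg_left hS.le_trace (sq_nonneg (maxStep n))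
  have h5 := mul_le_mul_of_nonneg_left h3 (show (0 : ℝ) ≤ 1 / (4 * n) by positivity)
  have h6 : 1 / (4 * (n : ℝ)) * (2 * (numAlive x - avg fun ε => numAlive (x + step x S ε)))
      = numAlive x / (2 * n) - 1 / (2 * n) * avg fun ε => numAlive (x + step x S ε) := by
    rcases n.eq_zero_or_pos with rfl | hn
    · simp
    · have : (0 : ℝ) < n := by exact_mod_cast hn
      field_simp; ring
  rw [h1, energy]
  linarith

theorem IsStepMatrix.avg_dotProduct_step_sq_le (hS : IsStepMatrix x c η S) (b : Fin n → ℝ) :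
    avg (fun ε => (b ⬝ᵥ step x S ε) ^ 2)
      ≤ maxStep n ^ 2 * (η * ∑ j, b j ^ 2 * ∑ i, S j i ^ 2) := by
  have key : ∀ ε, (b ⬝ᵥ step x S ε) ^ 2 ≤ maxStep n ^ 2 * (b ⬝ᵥ S *ᵥ signs ε) ^ 2 := by
    intro ε
    simp only [step, dotProduct_smul, smul_eq_mul, mul_pow]
    exact mul_le_mul_of_nonneg_right
      (pow_le_pow_left₀ (stepSize_nonneg _ _) (stepSize_le _ _) 2) (sq_nonneg _)
  refine (avg_mono key).trans ?_
  rw [avg_const_mul, avg_dotProduct_mulVec_sq]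
  exact mul_le_mul_of_nonneg_left (hS.le_diag b) (sq_nonneg _)

/-- If short steps are rare, then each coordinate of the step has the expected variance. -/
theorem le_avg_step_sq (x : Fin n → ℝ) (S : Matrix (Fin n) (Fin n) ℝ)
    (hq : avg (short x S) ≤ 1 / 12) (j : Fin n) :
    maxStep n ^ 2 * ∑ i, S j i ^ 2 ≤ 2 * avg fun ε => step x S ε j ^ 2 := by
  have h1 := avg_mono fun ε => le_step_sq x S ε j
  rw [avg_sub, avg_const_mul, avg_const_mul] at h1
  have h2 : avg (fun ε => (S *ᵥ signs ε) j ^ 2) = ∑ i, S j i ^ 2 := avg_dotProduct_sq (S j)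
  have h4 : avg (fun ε => (S *ᵥ signs ε) j ^ 4) ≤ 3 * (∑ i, S j i ^ 2) ^ 2 :=
    avg_dotProduct_pow_four (S j)
  set R := ∑ i, S j i ^ 2 with hR
  have hR0 : 0 ≤ R := Finset.sum_nonneg fun i _ => sq_nonneg _
  have h3 : avg (fun ε => short x S ε * (S *ᵥ signs ε) j ^ 2) ≤ R / 2 := by
    rcases hR0.eq_or_lt with h0 | hpos
    · refine (avg_mono fun ε => mul_le_of_le_one_left (sq_nonneg _)
        (short_le_one x S ε)).trans ?_
      rw [h2, ← h0]; norm_num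
    -- A linearised Cauchy–Schwarz inequality: short steps carry at most `√(1/12 · 3 R²) = R / 2` of
    -- the second moment.
    · have key : ∀ ε, 12 * R * (short x S ε * (S *ᵥ signs ε) j ^ 2)
          ≤ 36 * R ^ 2 * short x S ε + (S *ᵥ signs ε) j ^ 4 := by
        intro ε
        have ha := short_nonneg x S ε
        have hb := short_le_one x S ε
        have hc : (0 : ℝ) ≤ (S *ᵥ signs ε) j ^ 4 := by positivity
        nlinarith [mul_nonneg ha (sq_nonneg (6 * R - (S *ᵥ signs ε) j ^ 2))]
      have h5 := avg_mono key
      rw [avg_const_mul, avg_add, avg_const_mul] at h5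
      have h6 : 36 * R ^ 2 * avg (short x S) ≤ 36 * R ^ 2 * (1 / 12) :=
        mul_le_mul_of_nonneg_left hq (by positivity)
      have h7 : 12 * R * avg (fun ε => short x S ε * (S *ᵥ signs ε) j ^ 2) ≤ 12 * R * (R / 2) := by
        change _ ≤ 36 * R ^ 2 * avg (short x S) + _ at h5
        nlinarith
      exact le_of_mul_le_mul_left h7 (by positivity)
  rw [h2] at h1
  nlinarith [mul_le_mul_of_nonneg_left h3 (sq_nonneg (maxStep n))]

end

/-! ### The variance potential and its expected drop -/

/-- The parallel sum of `z` and `m / N` lies below its tangent planes. -/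
theorem parallel_le_tangent {N z m z' m' : ℝ} (hN : 0 < N) (hz : 0 ≤ z) (hm : 0 < m)
    (hz' : 0 ≤ z') (hm' : 0 < m') :
    z' * m' / (N * z' + m') ≤ z * m / (N * z + m) + (m / (N * z + m)) ^ 2 * (z' - z)
      - N * z ^ 2 / (N * z + m) ^ 2 * (m - m') := by
  have h1 : 0 < N * z + m := by positivity
  have h2 : 0 < N * z' + m' := by positivity
  -- Joint concavity in `(z, m)` made explicit: the defect from the tangent plane is a square over a
  -- positive denominator.
  have key : z * m / (N * z + m) + (m / (N * z + m)) ^ 2 * (z' - z)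
      - N * z ^ 2 / (N * z + m) ^ 2 * (m - m') - z' * m' / (N * z' + m')
      = N * (m * z' - z * m') ^ 2 / ((N * z + m) ^ 2 * (N * z' + m')) := by
    field_simp
    ring
  have : 0 ≤ N * (m * z' - z * m') ^ 2 / ((N * z + m) ^ 2 * (N * z' + m')) := by positivity
  linarith

/-- `xⱼ` or `1 - xⱼ`, depending on the orientation `o`. -/
def oriented {n : ℕ} (o : Fin n → Bool) (x : Fin n → ℝ) (j : Fin n) : ℝ :=
  if o j then x j else 1 - x j

/-- One more than the number of alive variables. -/
noncomputable def credit {n : ℕ} (x : Fin n → ℝ) : ℝ := numAlive x + 1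

/-- The parallel sum of `zⱼ` and `m / n³`, where `m` is the credit. -/
noncomputable def reserve {n : ℕ} (o : Fin n → Bool) (x : Fin n → ℝ) (j : Fin n) : ℝ :=
  oriented o x j * credit x / ((n : ℝ) ^ 3 * oriented o x j + credit x)

/-- The variance potential. -/
noncomputable def potential {n : ℕ} (o : Fin n → Bool) (a x : Fin n → ℝ) : ℝ :=
  ∑ j, a j ^ 2 * (x j - x j ^ 2 + reserve o x j)

/-- The gradient of the variance potential with respect to the solution. -/
noncomputable def slope {n : ℕ} (o : Fin n → Bool) (a x : Fin n → ℝ) (j : Fin n) : ℝ :=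
  a j ^ 2 * (1 - 2 * x j + (if o j then 1 else -1) *
    (credit x / ((n : ℝ) ^ 3 * oriented o x j + credit x)) ^ 2)

/-- The derivative of the reserve with respect to the credit. -/
noncomputable def weight {n : ℕ} (o : Fin n → Bool) (x : Fin n → ℝ) (j : Fin n) : ℝ :=
  (n : ℝ) ^ 3 * oriented o x j ^ 2 / ((n : ℝ) ^ 3 * oriented o x j + credit x) ^ 2

/-- The gap between the variance potential and its linearization. -/
noncomputable def drop {n : ℕ} (o : Fin n → Bool) (a x v : Fin n → ℝ) : ℝ :=
  potential o a x + slope o a x ⬝ᵥ v - potential o a (x + v)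

section

variable {n : ℕ} {x : Fin n → ℝ} (o : Fin n → Bool)

theorem credit_ge_one (x : Fin n → ℝ) : 1 ≤ credit x := by
  unfold credit; linarith [numAlive_nonneg x]

theorem credit_le (x : Fin n → ℝ) : credit x ≤ n + 1 := by
  unfold credit; linarith [numAlive_le x]

theorem oriented_nonneg (hx : x ∈ Set.Icc (0 : Fin n → ℝ) 1) (j : Fin n) :
    0 ≤ oriented o x j := by
  have h1 : 0 ≤ x j := hx.1 j
  have h2 : x j ≤ 1 := hx.2 j
  unfold oriented; split_ifs <;> linarith

theorem gap_le_oriented (x : Fin n → ℝ) (j : Fin n) : gap x j ≤ oriented o x j := by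
  unfold oriented gap; split_ifs
  · exact min_le_left _ _
  · exact min_le_right _ _

theorem oriented_add (x v : Fin n → ℝ) (j : Fin n) :
    oriented o (x + v) j - oriented o x j = (if o j then 1 else -1) * v j := by
  simp only [oriented, Pi.add_apply]; split_ifs <;> ring

theorem denom_pos (hx : x ∈ Set.Icc (0 : Fin n → ℝ) 1) (j : Fin n) :
    0 < (n : ℝ) ^ 3 * oriented o x j + credit x := by
  have := oriented_nonneg o hx j
  have := credit_ge_one x
  positivity

theorem reserve_nonneg (hx : x ∈ Set.Icc (0 : Fin n → ℝ) 1) (j : Fin n) : 0 ≤ reserve o x j := by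
  have := oriented_nonneg o hx j
  have := credit_ge_one x
  have := denom_pos o hx j
  unfold reserve; positivity

theorem reserve_le_oriented (hx : x ∈ Set.Icc (0 : Fin n → ℝ) 1) (j : Fin n) :
    reserve o x j ≤ oriented o x j := by
  have h1 := oriented_nonneg o hx j
  have h2 := credit_ge_one x
  unfold reserve
  rw [div_le_iff₀ (denom_pos o hx j)]
  nlinarith [mul_nonneg (pow_nonneg (Nat.cast_nonneg (α := ℝ) n) 3) (mul_nonneg h1 h1)]

theorem reserve_le (hx : x ∈ Set.Icc (0 : Fin n → ℝ) 1) (j : Fin n) :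
    reserve o x j ≤ 2 / (n : ℝ) ^ 2 := by
  have hn : (0 : ℝ) < n := by exact_mod_cast j.pos
  have hn1 : (1 : ℝ) ≤ n := by exact_mod_cast j.pos
  have h1 := oriented_nonneg o hx j
  have h2 := credit_ge_one x
  have h3 := credit_le x
  unfold reserve
  rw [div_le_div_iff₀ (denom_pos o hx j) (by positivity)]
  have h4 : oriented o x j * credit x * (n : ℝ) ^ 2 ≤ oriented o x j * (2 * n) * (n : ℝ) ^ 2 := by
    gcongr; linarith
  nlinarith

theorem weight_nonneg (hx : x ∈ Set.Icc (0 : Fin n → ℝ) 1) (j : Fin n) : 0 ≤ weight o x j := by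
  have := denom_pos o hx j
  unfold weight; positivity

theorem potential_nonneg (hx : x ∈ Set.Icc (0 : Fin n → ℝ) 1) (a : Fin n → ℝ) :
    0 ≤ potential o a x := by
  refine Finset.sum_nonneg fun j _ => mul_nonneg (sq_nonneg _) ?_
  have h1 : 0 ≤ x j := hx.1 j
  have h2 : x j ≤ 1 := hx.2 j
  nlinarith [reserve_nonneg o hx j]

theorem abs_slope_le (hx : x ∈ Set.Icc (0 : Fin n → ℝ) 1) (a : Fin n → ℝ) (j : Fin n) :
    |slope o a x j| ≤ 2 * a j ^ 2 := by
  have h1 : 0 ≤ x j := hx.1 j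
  have h2 : x j ≤ 1 := hx.2 j
  have h3 := oriented_nonneg o hx j
  have h4 := credit_ge_one x
  have h5 := denom_pos o hx j
  have h6 : 0 ≤ credit x / ((n : ℝ) ^ 3 * oriented o x j + credit x) := by positivity
  have h7 : credit x / ((n : ℝ) ^ 3 * oriented o x j + credit x) ≤ 1 := by
    rw [div_le_one h5]
    have : 0 ≤ (n : ℝ) ^ 3 * oriented o x j := by positivity
    linarith
  have h8 := pow_le_one₀ (n := 2) h6 h7
  have h9 := pow_nonneg h6 2
  unfold slope
  rw [abs_mul, abs_of_nonneg (sq_nonneg (a j)), mul_comm]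
  refine mul_le_mul_of_nonneg_right ?_ (sq_nonneg _)
  rw [abs_le]
  split_ifs <;> constructor <;> linarith

/-- The quadratic part contributes exactly `vⱼ²`. The reserve is linearised only in the solution,
with the credit held fixed, so a fall of the credit remains in the drop. -/
theorem drop_eq (a x v : Fin n → ℝ) : drop o a x v = ∑ j, a j ^ 2 * (v j ^ 2
    + (reserve o x j + (credit x / ((n : ℝ) ^ 3 * oriented o x j + credit x)) ^ 2
      * (oriented o (x + v) j - oriented o x j) - reserve o (x + v) j)) := by
  unfold drop potential dotProduct
  rw [← Finset.sum_add_distrib, ← Finset.sum_sub_distrib]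
  refine Finset.sum_congr rfl fun j _ => ?_
  rw [oriented_add]
  simp only [slope, Pi.add_apply]
  ring

/-- The tangent inequality for the reserve, whose credit derivative is `weight`. Movement and the
loss of alive variables are rewarded separately. -/
theorem le_drop (hx : x ∈ Set.Icc (0 : Fin n → ℝ) 1) {v : Fin n → ℝ}
    (hv : x + v ∈ Set.Icc (0 : Fin n → ℝ) 1) (a : Fin n → ℝ) :
    ∑ j, a j ^ 2 * v j ^ 2 + (∑ j, a j ^ 2 * weight o x j) * (numAlive x - numAlive (x + v))
      ≤ drop o a x v := by
  rw [drop_eq, Finset.sum_mul, ← Finset.sum_add_distrib]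
  refine Finset.sum_le_sum fun j _ => ?_
  have hn : (0 : ℝ) < n := by exact_mod_cast j.pos
  have h := parallel_le_tangent (N := (n : ℝ) ^ 3) (by positivity) (oriented_nonneg o hx j)
    (zero_lt_one.trans_le (credit_ge_one x)) (oriented_nonneg o hv j)
    (zero_lt_one.trans_le (credit_ge_one (x + v)))
  have h2 : credit x - credit (x + v) = numAlive x - numAlive (x + v) := by
    unfold credit; ring
  rw [h2] at h
  rw [mul_assoc, ← mul_add]
  refine mul_le_mul_of_nonneg_left ?_ (sq_nonneg _)
  unfold reserve weight
  linarith

/-- In this range `n³ z` dominates the credit up to a constant, so the weight has order at least `1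
/ n³`, comparable to `γ²`. -/
theorem weight_ge_of_large (hx : x ∈ Set.Icc (0 : Fin n → ℝ) 1) (j : Fin n)
    (h : 1 / (n : ℝ) ^ 2 ≤ oriented o x j) : 1 / (9 * (n : ℝ) ^ 3) ≤ weight o x j := by
  have hn : (0 : ℝ) < n := by exact_mod_cast j.pos
  have hn1 : (1 : ℝ) ≤ n := by exact_mod_cast j.pos
  have h3 := credit_le x
  have h4 := credit_ge_one x
  have h5 := denom_pos o hx j
  have h6 : (n : ℝ) ≤ (n : ℝ) ^ 3 * oriented o x j := by
    rw [div_le_iff₀ (by positivity)] at h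
    nlinarith
  have h7 : (n : ℝ) ^ 3 * oriented o x j + credit x ≤ 3 * ((n : ℝ) ^ 3 * oriented o x j) := by
    linarith
  have h8 := pow_le_pow_left₀ h5.le h7 2
  unfold weight
  rw [div_le_div_iff₀ (by positivity) (by positivity)]
  nlinarith

/-- In this range the denominator is at most `3 n`. A step changes the variable by at most `z`, so
the weight pays even for the worst case with the factor `n` from Cauchy–Schwarz. -/
theorem weight_ge_of_small (hx : x ∈ Set.Icc (0 : Fin n → ℝ) 1) (j : Fin n)
    (h : oriented o x j ≤ 1 / (n : ℝ) ^ 2) : n * oriented o x j ^ 2 ≤ 9 * weight o x j := by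
  have hn : (0 : ℝ) < n := by exact_mod_cast j.pos
  have hn1 : (1 : ℝ) ≤ n := by exact_mod_cast j.pos
  have h3 := credit_le x
  have h4 := credit_ge_one x
  have h5 := denom_pos o hx j
  have h6 : (n : ℝ) ^ 3 * oriented o x j ≤ n := by
    rw [le_div_iff₀ (by positivity)] at h
    nlinarith
  have h7 : (n : ℝ) ^ 3 * oriented o x j + credit x ≤ 3 * n := by linarith
  have h8 := pow_le_pow_left₀ h5.le h7 2
  unfold weight
  rw [mul_div_assoc', le_div_iff₀ (by positivity)]
  calc n * oriented o x j ^ 2 * ((n : ℝ) ^ 3 * oriented o x j + credit x) ^ 2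
      ≤ n * oriented o x j ^ 2 * (3 * n) ^ 2 := by gcongr
    _ = 9 * ((n : ℝ) ^ 3 * oriented o x j ^ 2) := by ring

variable {c η : ℝ} {S : Matrix (Fin n) (Fin n) ℝ}

theorem IsStepMatrix.drop_nonneg (hS : IsStepMatrix x c η S)
    (hx : x ∈ Set.Icc (0 : Fin n → ℝ) 1) (a : Fin n → ℝ) (ε : Fin n → Bool) :
    0 ≤ drop o a x (step x S ε) := by
  refine le_trans ?_ (le_drop o hx (hS.add_step_mem hx ε) a)
  refine add_nonneg (Finset.sum_nonneg fun j _ => by positivity) (mul_nonneg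
    (Finset.sum_nonneg fun j _ => mul_nonneg (sq_nonneg _) (weight_nonneg o hx j))
    (sub_nonneg.2 (numAlive_add_le (hS.abs_step_le hx ε))))

/-- Each coordinate contributes at most `(1/4 + 2 + 1/2) / n` times `‖a‖²`. Boundedness is needed to
linearise the exponential. -/
theorem IsStepMatrix.drop_le (hS : IsStepMatrix x c η S)
    (hx : x ∈ Set.Icc (0 : Fin n → ℝ) 1) (a : Fin n → ℝ) (ε : Fin n → Bool) :
    drop o a x (step x S ε) ≤ 3 * ‖a‖ ^ 2 := by
  rcases n.eq_zero_or_pos with h0 | hn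
  · subst h0
    rw [drop_eq]; simp
  have hn1 : (1 : ℝ) ≤ n := by exact_mod_cast hn
  have hn' : (0 : ℝ) < n := by linarith
  rw [drop_eq]
  have key : ∀ j, a j ^ 2 * (step x S ε j ^ 2
    + (reserve o x j + (credit x / ((n : ℝ) ^ 3 * oriented o x j + credit x)) ^ 2
      * (oriented o (x + step x S ε) j - oriented o x j) - reserve o (x + step x S ε) j))
      ≤ ‖a‖ ^ 2 * (3 / n) := by
    intro j
    have h1 : a j ^ 2 ≤ ‖a‖ ^ 2 := by
      rw [← sq_abs (a j), ← Real.norm_eq_abs]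
      exact pow_le_pow_left₀ (norm_nonneg _) (norm_le_pi_norm a j) 2
    have h2 := hS.step_sq_le ε j
    have h3 := hS.abs_step_le_div ε j
    have h4 := reserve_le o hx j
    have h5 := reserve_nonneg o (hS.add_step_mem hx ε) j
    have h6 := credit_ge_one x
    have h7 := denom_pos o hx j
    have h8 : credit x / ((n : ℝ) ^ 3 * oriented o x j + credit x) ≤ 1 := by
      rw [div_le_one h7]
      have : 0 ≤ (n : ℝ) ^ 3 * oriented o x j := by
        have := oriented_nonneg o hx j
        positivity
      linarith
    have h9 := pow_le_one₀ (n := 2) (by positivity) h8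
    have h10 : (0 : ℝ) ≤ (credit x / ((n : ℝ) ^ 3 * oriented o x j + credit x)) ^ 2 := sq_nonneg _
    have h11 : (credit x / ((n : ℝ) ^ 3 * oriented o x j + credit x)) ^ 2
      * (oriented o (x + step x S ε) j - oriented o x j) ≤ |step x S ε j| := by
      rw [oriented_add]
      refine (mul_le_mul_of_nonneg_left (b := _) (c := |step x S ε j|) ?_ h10).trans
        (mul_le_of_le_one_left (abs_nonneg _) h9)
      split_ifs
      · rw [one_mul]; exact le_abs_self _
      · rw [neg_one_mul]; exact neg_le_abs _
    have h12 : 1 / (4 * (n : ℝ) ^ 2) + 2 / (n : ℝ) ^ 2 + 1 / (2 * n) ≤ 3 / n := by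
      have : 1 / (n : ℝ) ^ 2 ≤ 1 / n := by
        apply one_div_le_one_div_of_le hn'; nlinarith
      have e1 : 1 / (4 * (n : ℝ) ^ 2) = 1 / 4 * (1 / (n : ℝ) ^ 2) := by field_simp
      have e2 : 2 / (n : ℝ) ^ 2 = 2 * (1 / (n : ℝ) ^ 2) := by field_simp
      have e3 : 1 / (2 * (n : ℝ)) = 1 / 2 * (1 / n) := by field_simp
      have e4 : 3 / (n : ℝ) = 3 * (1 / n) := by field_simp
      have : 0 < 1 / (n : ℝ) := by positivity
      rw [e1, e2, e3, e4]; linarith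
    calc _ ≤ a j ^ 2 * (3 / n) := mul_le_mul_of_nonneg_left (by linarith) (sq_nonneg _)
      _ ≤ ‖a‖ ^ 2 * (3 / n) := mul_le_mul_of_nonneg_right h1 (by positivity)
  refine (Finset.sum_le_sum fun j _ => key j).trans_eq ?_
  simp only [Finset.sum_const, Finset.card_univ, Fintype.card_fin, nsmul_eq_mul]
  field_simp

theorem IsStepMatrix.sum_sq_le_avg_drop (hS : IsStepMatrix x c η S)
    (hx : x ∈ Set.Icc (0 : Fin n → ℝ) 1) (a : Fin n → ℝ) :
    ∑ j, a j ^ 2 * avg (fun ε => step x S ε j ^ 2)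
      ≤ avg fun ε => drop o a x (step x S ε) := by
  simp only [← avg_const_mul]
  rw [← avg_sum]
  refine avg_mono fun ε => le_trans ?_ (le_drop o hx (hS.add_step_mem hx ε) a)
  exact le_add_of_nonneg_right (mul_nonneg
    (Finset.sum_nonneg fun j _ => mul_nonneg (sq_nonneg _) (weight_nonneg o hx j))
    (sub_nonneg.2 (numAlive_add_le (hS.abs_step_le hx ε))))

theorem IsStepMatrix.sum_weight_le_avg_drop (hS : IsStepMatrix x c η S)
    (hx : x ∈ Set.Icc (0 : Fin n → ℝ) 1) (a : Fin n → ℝ) :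
    (∑ j, a j ^ 2 * weight o x j) * avg (short x S)
      ≤ 2 * avg fun ε => drop o a x (step x S ε) := by
  have h0 : 0 ≤ ∑ j, a j ^ 2 * weight o x j :=
    Finset.sum_nonneg fun j _ => mul_nonneg (sq_nonneg _) (weight_nonneg o hx j)
  have h1 : avg (fun ε => (∑ j, a j ^ 2 * weight o x j)
      * (numAlive x - numAlive (x + step x S ε))) ≤ avg fun ε => drop o a x (step x S ε) := by
    refine avg_mono fun ε => le_trans ?_ (le_drop o hx (hS.add_step_mem hx ε) a)
    exact le_add_of_nonneg_left (Finset.sum_nonneg fun j _ => by positivity)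
  rw [avg_const_mul, avg_sub, avg_const] at h1
  nlinarith [mul_le_mul_of_nonneg_left (hS.avg_numAlive_le hx) h0]

/-- The variance of a linear form of the step is controlled by the expected drop of the
potential. -/
theorem IsStepMatrix.avg_sq_le_avg_drop (hS : IsStepMatrix x c η S)
    (hx : x ∈ Set.Icc (0 : Fin n → ℝ) 1) (hη : 1 ≤ η) {a b : Fin n → ℝ} {κ : ℝ} (hκ : 0 ≤ κ)
    (hb : ∀ j, b j ^ 2 ≤ κ * a j ^ 2) :
    avg (fun ε => (b ⬝ᵥ step x S ε) ^ 2)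
      ≤ 864 * κ * η * avg fun ε => drop o a x (step x S ε) := by
  set D := avg fun ε => drop o a x (step x S ε) with hD
  have hD0 : 0 ≤ D := avg_nonneg fun ε => hS.drop_nonneg o hx a ε
  have hη0 : 0 ≤ η := by linarith
  obtain ⟨R, hR⟩ : ∃ R : Fin n → ℝ, ∀ j, ∑ i, S j i ^ 2 = R j := ⟨_, fun _ => rfl⟩
  have hR0 : ∀ j, 0 ≤ R j := fun j => by
    rw [← hR]; exact Finset.sum_nonneg fun i _ => sq_nonneg _
  have hvar := hS.avg_dotProduct_step_sq_le
  have hrow := hS.row_le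
  simp only [hR] at hvar hrow
  -- Rare short steps: coordinate variances survive up to a factor `2`, and `S` is controlled by its
  -- diagonal.
  by_cases hq : avg (short x S) ≤ 1 / 12
  · have h1 := hvar b
    have h2 : maxStep n ^ 2 * (η * ∑ j, b j ^ 2 * R j)
        ≤ η * (κ * (2 * ∑ j, a j ^ 2 * avg (fun ε => step x S ε j ^ 2))) := by
      rw [mul_left_comm]
      refine mul_le_mul_of_nonneg_left ?_ hη0
      simp only [Finset.mul_sum]
      refine Finset.sum_le_sum fun j _ => ?_
      calc maxStep n ^ 2 * (b j ^ 2 * R j)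
          = b j ^ 2 * (maxStep n ^ 2 * R j) := by ring
        _ ≤ (κ * a j ^ 2) * (2 * avg fun ε => step x S ε j ^ 2) :=
            mul_le_mul (hb j) (hR j ▸ le_avg_step_sq x S hq j)
              (mul_nonneg (sq_nonneg _) (hR0 j)) (by positivity)
        _ = _ := by ring
    have h3 := hS.sum_sq_le_avg_drop o hx a
    have h4 : η * (κ * (2 * ∑ j, a j ^ 2 * avg (fun ε => step x S ε j ^ 2)))
        ≤ η * (κ * (2 * D)) := by gcongr
    have h5 : 0 ≤ κ * η * D := by positivity
    nlinarith
  -- Frequent short steps: the expected loss of alive variables exceeds `1 / 24`, so the total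
  -- weight is at most `24 D`.
  · push Not at hq
    have hW := hS.sum_weight_le_avg_drop o hx a
    set w := ∑ j, a j ^ 2 * weight o x j with hw
    have hw0 : 0 ≤ w :=
      Finset.sum_nonneg fun j _ => mul_nonneg (sq_nonneg _) (weight_nonneg o hx j)
    have hwD : w ≤ 24 * D := by nlinarith
    -- Coordinates far from the chosen end are treated by variance, near ones by the pointwise
    -- bound. Each part costs `9 κ η w`, so the total is `(2 + 2) · 9 · 24 = 864`.
    set bL : Fin n → ℝ := fun j => if 1 / (n : ℝ) ^ 2 ≤ oriented o x j then b j else 0 with hbL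
    set bH : Fin n → ℝ := fun j => if 1 / (n : ℝ) ^ 2 ≤ oriented o x j then 0 else b j with hbH
    have hsplit : ∀ v : Fin n → ℝ, (b ⬝ᵥ v) ^ 2 ≤ 2 * (bL ⬝ᵥ v) ^ 2 + 2 * (bH ⬝ᵥ v) ^ 2 := by
      intro v
      have : b = bL + bH := by
        ext j; simp only [hbL, hbH, Pi.add_apply]; split_ifs <;> simp
      rw [this, add_dotProduct]
      nlinarith [sq_nonneg (bL ⬝ᵥ v - bH ⬝ᵥ v)]
    have hL : avg (fun ε => (bL ⬝ᵥ step x S ε) ^ 2) ≤ 9 * (κ * (η * w)) := by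
      refine (hvar bL).trans ?_
      rw [hw, mul_left_comm]
      simp only [Finset.mul_sum]
      refine Finset.sum_le_sum fun j _ => ?_
      have hn : (0 : ℝ) < n := by exact_mod_cast j.pos
      have hwj := weight_nonneg o hx j
      by_cases h : 1 / (n : ℝ) ^ 2 ≤ oriented o x j
      · have h1 := weight_ge_of_large o hx j h
        have h2 : maxStep n ^ 2 ≤ 9 * weight o x j := by
          rw [maxStep_sq]
          have e : 1 / (4 * (n : ℝ) ^ 3) = 9 / 4 * (1 / (9 * (n : ℝ) ^ 3)) := by field_simp
          rw [e]; linarith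
        have h3 : bL j = b j := by simp only [hbL, if_pos h]
        rw [h3]
        calc η * (maxStep n ^ 2 * (b j ^ 2 * R j))
            ≤ η * ((9 * weight o x j) * ((κ * a j ^ 2) * 1)) := by
              have := hb j
              have := hrow j
              have := hR0 j
              gcongr
          _ = _ := by ring
      · have h3 : bL j = 0 := by simp only [hbL, if_neg h]
        rw [h3]
        have : 0 ≤ 9 * (κ * (η * (a j ^ 2 * weight o x j))) := by positivity
        simpa using this
    have hH : avg (fun ε => (bH ⬝ᵥ step x S ε) ^ 2) ≤ 9 * (κ * w) := by
      rw [← avg_const (n := n) (9 * (κ * w))]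
      refine avg_mono fun ε => ?_
      have h1 := sq_sum_le_card_mul_sum_sq (s := Finset.univ) (f := fun j => bH j * step x S ε j)
      refine h1.trans ?_
      rw [hw]
      simp only [Finset.mul_sum, Finset.card_univ, Fintype.card_fin]
      refine Finset.sum_le_sum fun j _ => ?_
      have hwj := weight_nonneg o hx j
      by_cases h : 1 / (n : ℝ) ^ 2 ≤ oriented o x j
      · have h3 : bH j = 0 := by simp only [hbH, if_pos h]
        rw [h3]
        have : 0 ≤ 9 * (κ * (a j ^ 2 * weight o x j)) := by positivity
        simpa using this
      · have h3 : bH j = b j := by simp only [hbH, if_neg h]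
        have h4 := weight_ge_of_small o hx j (not_le.1 h).le
        have h5 : step x S ε j ^ 2 ≤ oriented o x j ^ 2 := by
          rw [← sq_abs (step x S ε j)]
          exact pow_le_pow_left₀ (abs_nonneg _)
            ((hS.abs_step_le hx ε j).trans (gap_le_oriented o x j)) 2
        rw [h3]
        calc (n : ℝ) * (b j * step x S ε j) ^ 2 = b j ^ 2 * (n * step x S ε j ^ 2) := by ring
          _ ≤ (κ * a j ^ 2) * (n * oriented o x j ^ 2) := by
              have := hb j
              gcongr
          _ ≤ (κ * a j ^ 2) * (9 * weight o x j) := by gcongr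
          _ = _ := by ring
    have h1 := avg_mono fun ε => hsplit (step x S ε)
    rw [avg_add, avg_const_mul, avg_const_mul] at h1
    have h2 : κ * w ≤ κ * (η * w) := by
      refine mul_le_mul_of_nonneg_left ?_ hκ
      nlinarith
    have h3 : κ * (η * w) ≤ κ * (η * (24 * D)) := by gcongr
    nlinarith

end

/-! ### The exponential supermartingale -/

theorem exp_sub_le {v u : ℝ} (hv : |v| ≤ 1 / 2) (hu : 0 ≤ u) (hu1 : u ≤ 1 / 2) :
    Real.exp (v - u) ≤ 1 + v + v ^ 2 - u / 4 := by
  have h1 := abs_le.1 (Real.abs_exp_sub_one_sub_id_le (x := v) (by linarith))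
  have h2 := abs_le.1 (Real.abs_exp_sub_one_sub_id_le (x := -u)
    (by rw [abs_neg, abs_of_nonneg hu]; linarith))
  have h3 := abs_le.1 hv
  have h4 : Real.exp (-u) ≤ 1 - u / 2 := by nlinarith
  have h5 : Real.exp v ≤ 1 + v + v ^ 2 := by linarith
  -- This lower bound leaves at least half of the saving `u / 2` after multiplication by `exp v`.
  have h6 : 1 / 2 ≤ Real.exp v := by linarith [Real.add_one_le_exp v]
  rw [sub_eq_add_neg, Real.exp_add]
  have := Real.exp_pos v
  nlinarith

/-- One step of the exponential supermartingale. -/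
theorem IsStepMatrix.avg_exp_le {n : ℕ} {x : Fin n → ℝ} {c η : ℝ}
    {S : Matrix (Fin n) (Fin n) ℝ} (hS : IsStepMatrix x c η S)
    (hx : x ∈ Set.Icc (0 : Fin n → ℝ) 1) (hη : 1 ≤ η) (o : Fin n → Bool) (a : Fin n → ℝ) {l : ℝ}
    (hl : 0 ≤ l) (hla : l * (13824 * η) * ‖a‖ ≤ 1 / 2) :
    avg (fun ε => Real.exp (l * (a ⬝ᵥ (x + step x S ε))
        + l ^ 2 * (13824 * η) * potential o a (x + step x S ε)))
      ≤ Real.exp (l * (a ⬝ᵥ x) + l ^ 2 * (13824 * η) * potential o a x) := by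
  set μ := l ^ 2 * (13824 * η) with hμ
  have hμ0 : 0 ≤ μ := by positivity
  set b : Fin n → ℝ := l • a + μ • slope o a x with hb
  set E := Real.exp (l * (a ⬝ᵥ x) + μ * potential o a x) with hE
  have hlM : l * ‖a‖ ≤ 1 / 27648 := by
    have h0 : 0 ≤ l * ‖a‖ := by positivity
    nlinarith
  -- The linear term combines `l a` with the gradient of the potential; `hla` makes the second part
  -- no larger than the first.
  have hbj : ∀ j, |b j| ≤ 2 * l * |a j| := by
    intro j
    have h1 := abs_slope_le o hx a j
    have h2 : |a j| ≤ ‖a‖ := norm_le_pi_norm a j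
    simp only [hb, Pi.add_apply, Pi.smul_apply, smul_eq_mul]
    refine (abs_add_le _ _).trans ?_
    rw [abs_mul, abs_mul, abs_of_nonneg hl, abs_of_nonneg hμ0]
    have h3 : μ * |slope o a x j| ≤ μ * (2 * (|a j| * ‖a‖)) := by
      refine mul_le_mul_of_nonneg_left (h1.trans ?_) hμ0
      rw [← sq_abs, sq]
      gcongr
    have h4 : μ * (2 * (|a j| * ‖a‖)) = 2 * (l * |a j|) * (l * (13824 * η) * ‖a‖) := by
      rw [hμ]; ring
    have h5 : 0 ≤ l * |a j| := by positivity
    nlinarith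
  have hbsq : ∀ j, b j ^ 2 ≤ (4 * l ^ 2) * a j ^ 2 := by
    intro j
    rw [← sq_abs (b j), ← sq_abs (a j)]
    refine (pow_le_pow_left₀ (abs_nonneg _) (hbj j) 2).trans_eq ?_
    ring
  have hvar := hS.avg_sq_le_avg_drop o hx hη (by positivity) hbsq
  have key : ∀ ε, Real.exp (l * (a ⬝ᵥ (x + step x S ε))
        + μ * potential o a (x + step x S ε))
      ≤ E * (1 + b ⬝ᵥ step x S ε + (b ⬝ᵥ step x S ε) ^ 2
        - μ / 4 * drop o a x (step x S ε)) := by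
    intro ε
    have e1 : l * (a ⬝ᵥ (x + step x S ε)) + μ * potential o a (x + step x S ε)
        = l * (a ⬝ᵥ x) + μ * potential o a x
          + (b ⬝ᵥ step x S ε - μ * drop o a x (step x S ε)) := by
      simp only [drop, hb, dotProduct_add, add_dotProduct, smul_dotProduct, smul_eq_mul]
      ring
    rw [e1, Real.exp_add]
    refine mul_le_mul_of_nonneg_left ?_ (Real.exp_pos _).le
    have hv : |b ⬝ᵥ step x S ε| ≤ 1 / 2 := by
      have h1 : |b ⬝ᵥ step x S ε| ≤ ∑ j : Fin n, (2 * l * ‖a‖) * (1 / (2 * (n : ℝ))) := by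
        refine (Finset.abs_sum_le_sum_abs _ _).trans (Finset.sum_le_sum fun j _ => ?_)
        rw [abs_mul]
        refine mul_le_mul ((hbj j).trans ?_) (hS.abs_step_le_div ε j) (abs_nonneg _)
          (by positivity)
        exact mul_le_mul_of_nonneg_left (norm_le_pi_norm a j) (by positivity)
      refine h1.trans ?_
      simp only [Finset.sum_const, Finset.card_univ, Fintype.card_fin, nsmul_eq_mul]
      rcases n.eq_zero_or_pos with h0 | hn
      · simp [h0]
      · have : (0 : ℝ) < n := by exact_mod_cast hn
        have e2 : (n : ℝ) * ((2 * l * ‖a‖) * (1 / (2 * (n : ℝ)))) = l * ‖a‖ := by field_simp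
        rw [e2]; linarith
    have hu : μ * drop o a x (step x S ε) ≤ 1 / 2 := by
      refine (mul_le_mul_of_nonneg_left (hS.drop_le o hx a ε) hμ0).trans ?_
      have e3 : μ * (3 * ‖a‖ ^ 2) = 3 * (l * ‖a‖) * (l * (13824 * η) * ‖a‖) := by rw [hμ]; ring
      rw [e3]
      have h0 : 0 ≤ l * ‖a‖ := by positivity
      nlinarith
    refine (exp_sub_le hv (mul_nonneg hμ0 (hS.drop_nonneg o hx a ε)) hu).trans_eq ?_
    ring
  refine (avg_mono key).trans ?_
  rw [avg_const_mul, avg_sub, avg_add, avg_add, avg_const, avg_dotProduct_step, avg_const_mul]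
  refine mul_le_of_le_one_right (Real.exp_pos _).le ?_
  -- The choice `13824 = 4 · 4 · 864` makes the variance bound cancel the quarter of the drop kept
  -- by `exp_sub_le`.
  have e4 : 864 * (4 * l ^ 2) * η * avg (fun ε => drop o a x (step x S ε))
      = μ / 4 * avg fun ε => drop o a x (step x S ε) := by rw [hμ]; ring
  rw [e4] at hvar
  linarith

/-! ### The path of the algorithm for fixed signs -/

section

variable {n : ℕ}

theorem direction_eq_zero (x : Fin n → ℝ) (U : Matrix (Alive x) (Alive x) ℝ) (r : Fin n → ℝ)
    (j : Fin n) (hj : ¬ (0 < x j ∧ x j < 1)) : direction x U r j = 0 := by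
  rw [direction, dif_neg hj]

theorem update_mem {x : Fin n → ℝ} (hx : x ∈ Set.Icc (0 : Fin n → ℝ) 1)
    (U : Matrix (Alive x) (Alive x) ℝ) (r : Fin n → ℝ) :
    update x U r ∈ Set.Icc (0 : Fin n → ℝ) 1 :=
  ((mem_cube_iff x _).2 (abs_stepSize_mul_le hx (direction_eq_zero x U r))).1

theorem update_apply_of_not_alive (x : Fin n → ℝ) (U : Matrix (Alive x) (Alive x) ℝ)
    (r : Fin n → ℝ) (j : Fin n) (hj : ¬ (0 < x j ∧ x j < 1)) : update x U r j = x j := by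
  simp [update, direction_eq_zero x U r j hj]

theorem solution_mem (U : CovRule n) {x : Fin n → ℝ} (hx : x ∈ Set.Icc (0 : Fin n → ℝ) 1)
    (r : ℕ → Fin n → ℝ) (k : ℕ) : solution U x r k ∈ Set.Icc (0 : Fin n → ℝ) 1 := by
  induction k with
  | zero => exact hx
  | succ k ih => exact update_mem ih _ _

theorem solution_apply_of_not_alive (U : CovRule n) (x : Fin n → ℝ) (r : ℕ → Fin n → ℝ)
    {k l : ℕ} (hkl : k ≤ l) (j : Fin n)
    (hj : ¬ (0 < solution U x r k j ∧ solution U x r k j < 1)) :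
    solution U x r l j = solution U x r k j := by
  induction l, hkl using Nat.le_induction with
  | base => rfl
  | succ l _ ih =>
    rw [← ih] at hj ⊢
    exact update_apply_of_not_alive _ _ _ j hj

theorem IsIntegral.not_alive {x : Fin n → ℝ} (h : IsIntegral x) (j : Fin n) :
    ¬ (0 < x j ∧ x j < 1) := by
  rcases h j with h | h <;> rw [h] <;> norm_num

theorem isIntegral_of_numAlive {x : Fin n → ℝ} (hx : x ∈ Set.Icc (0 : Fin n → ℝ) 1)
    (h : Fintype.card (Alive x) = 0) : IsIntegral x := by
  intro j
  have h1 : ¬ (0 < x j ∧ x j < 1) := fun hj =>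
    (Fintype.card_eq_zero_iff.1 h).false ⟨j, hj⟩
  have h2 : 0 ≤ x j := hx.1 j
  have h3 : x j ≤ 1 := hx.2 j
  rcases h2.eq_or_lt with h0 | h0
  · exact Or.inl h0.symm
  · exact Or.inr (le_antisymm h3 (not_lt.1 fun hc => h1 ⟨h0, hc⟩))

theorem solution_eq_of_isIntegral (U : CovRule n) (x : Fin n → ℝ) (r : ℕ → Fin n → ℝ)
    {k l : ℕ} (hkl : k ≤ l) (h : IsIntegral (solution U x r k)) :
    solution U x r l = solution U x r k :=
  funext fun j => solution_apply_of_not_alive U x r hkl j (h.not_alive j)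

theorem solution_congr (U : CovRule n) (x : Fin n → ℝ) {r r' : ℕ → Fin n → ℝ} {k : ℕ}
    (h : ∀ i < k, r i = r' i) : solution U x r k = solution U x r' k := by
  induction k with
  | zero => rfl
  | succ k ih =>
    simp only [solution]
    rw [ih fun i hi => h i (by omega), h k (by omega)]

theorem iterations_le (U : CovRule n) (x : Fin n → ℝ) (r : ℕ → Fin n → ℝ) {k : ℕ}
    (h : IsIntegral (solution U x r k)) : iterations U x r ≤ k :=
  iInf₂_le k h

theorem isIntegral_output (U : CovRule n) (x : Fin n → ℝ) (r : ℕ → Fin n → ℝ)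
    (h : iterations U x r ≠ ⊤) :
    ∃ k, IsIntegral (solution U x r k) ∧ output U x r = solution U x r k := by
  classical
  have hex : ∃ k, IsIntegral (solution U x r k) := by
    by_contra hc
    push Not at hc
    exact h (by simp [iterations, hc])
  refine ⟨Nat.find hex, Nat.find_spec hex, ?_⟩
  have : iterations U x r = (Nat.find hex : ℕ∞) := by
    refine le_antisymm (iterations_le U x r (Nat.find_spec hex)) ?_
    exact le_iInf₂ fun k hk => Nat.cast_le.2 (Nat.find_min' hex hk)
  rw [output, this, ENat.toNat_natCast]

open scoped Classical in
-- Counting the non-integral times allows the expectation to be bounded term by term; the sum is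
-- infinite if no time is integral.
theorem iterations_le_tsum (U : CovRule n) (x : Fin n → ℝ) (r : ℕ → Fin n → ℝ) :
    (iterations U x r : ℝ≥0∞) ≤ ∑' k, if IsIntegral (solution U x r k) then 0 else 1 := by
  by_cases hex : ∃ k, IsIntegral (solution U x r k)
  · have h1 : (iterations U x r : ℝ≥0∞) ≤ (Nat.find hex : ℕ) := by
      have := iterations_le U x r (Nat.find_spec hex)
      exact_mod_cast ENat.toENNReal_le.2 this
    refine h1.trans ?_
    refine le_trans ?_ (ENNReal.sum_le_tsum (Finset.range (Nat.find hex)))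
    rw [Finset.sum_congr rfl fun k hk => if_neg (Nat.find_min hex (Finset.mem_range.1 hk))]
    simp
  · push Not at hex
    simp only [hex, if_false]
    rw [ENNReal.tsum_const_eq_top_of_ne_zero one_ne_zero]
    exact le_top

/-- The rounding error of each row. -/
theorem abs_row_error_le {m : ℕ} {A : Matrix (Fin m) (Fin n) ℝ} {t δ : ℝ} (ht : 0 ≤ t)
    (hδ1 : δ < 1) {U : CovRule n} (hU : U.IsValid A t δ) {x : Fin n → ℝ}
    (hx : x ∈ Set.Icc (0 : Fin n → ℝ) 1) (r : ℕ → Fin n → ℝ) {k : ℕ}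
    (hk : IsIntegral (solution U x r k)) (i : Fin m) :
    |(A *ᵥ (solution U x r k - x)) i| ≤ t / (1 - δ) := by
  classical
  have hnb : ¬ IsBig A t δ (solution U x r k) i := by
    unfold IsBig
    rw [not_lt, sum_alive (solution U x r k) fun j => |A i j|]
    rw [Finset.sum_eq_zero fun j _ => dif_neg (hk.not_alive j)]
    exact div_nonneg ht (by linarith)
  have hex : ∃ l, ¬ IsBig A t δ (solution U x r l) i := ⟨k, hnb⟩
  set l := Nat.find hex with hl
  have hlk : l ≤ k := Nat.find_min' hex hnb
  -- Before the first time `l` at which row `i` is not big, it lies in the span and is orthogonal to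
  -- every step.
  have hconst : ∀ p ≤ l, (A *ᵥ solution U x r p) i = (A *ᵥ x) i := by
    intro p
    induction p with
    | zero => intro _; rfl
    | succ p ih =>
      intro hp
      rw [← ih (by omega)]
      set y := solution U x r p with hy
      have hbig : IsBig A t δ y i := not_not.1 (Nat.find_min hex (by omega))
      have hfeas := hU p y (solution_mem U hx r p)
      have horth := hfeas.sum_mul_stepMatrix (A i) (Submodule.subset_span ⟨i, hbig, rfl⟩)
      have h0 : (A *ᵥ direction y (U p y) (r p)) i = 0 := by
        rw [direction_eq, Matrix.mulVec_mulVec]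
        show ∑ q, (A * stepMatrix y (U p y)) i q * r p q = 0
        refine Finset.sum_eq_zero fun q _ => ?_
        rw [Matrix.mul_apply, horth q, zero_mul]
      simp only [solution, update]
      rw [Matrix.mulVec_add, Matrix.mulVec_smul, Pi.add_apply, Pi.smul_apply, ← hy, h0, smul_zero,
        add_zero]
  have h1 : (A *ᵥ (solution U x r k - x)) i
      = ∑ j, A i j * (solution U x r k j - solution U x r l j) := by
    rw [Matrix.mulVec_sub, Pi.sub_apply, ← hconst l le_rfl, ← Pi.sub_apply, ← Matrix.mulVec_sub]
    rfl
  rw [h1]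
  have hbl : ¬ IsBig A t δ (solution U x r l) i := Nat.find_spec hex
  -- After time `l` each alive variable changes by at most `1` in total, and frozen ones do not
  -- change.
  refine le_trans ?_ (not_lt.1 hbl)
  rw [sum_alive (solution U x r l) fun j => |A i j|]
  refine (Finset.abs_sum_le_sum_abs _ _).trans (Finset.sum_le_sum fun j _ => ?_)
  have hm1 := solution_mem U hx r k
  have hm2 := solution_mem U hx r l
  split_ifs with hj
  · rw [abs_mul]
    refine mul_le_of_le_one_right (abs_nonneg _) ?_
    have a1 : 0 ≤ solution U x r k j := hm1.1 j
    have a2 : solution U x r k j ≤ 1 := hm1.2 j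
    have a3 : 0 ≤ solution U x r l j := hm2.1 j
    have a4 : solution U x r l j ≤ 1 := hm2.2 j
    rw [abs_le]; constructor <;> linarith
  · rw [solution_apply_of_not_alive U x r hlk j hj]; simp

end

/-! ### Random signs -/

section

variable {Ω : Type*} [MeasurableSpace Ω] {P : Measure Ω} {n : ℕ} {r : ℕ → Fin n → Ω → ℝ}

/-- The random signs of iteration `k` as a Boolean vector. -/
noncomputable def bits (r : ℕ → Fin n → Ω → ℝ) (k : ℕ) (ω : Ω) : Fin n → Bool :=
  fun j => decide (r k j ω = 1)

theorem IsRandomSigns.signs_bits (hr : IsRandomSigns P r) (k : ℕ) (ω : Ω) :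
    signs (bits r k ω) = fun j => r k j ω := by
  ext j
  rcases hr.eq_or_eq k j ω with h | h
  · simp [signs, bits, h]
  · simp only [signs, bits, h]; norm_num

/-- The history before iteration `k`. -/
noncomputable def history (r : ℕ → Fin n → Ω → ℝ) (k : ℕ) (ω : Ω) :
    (Finset.range k ×ˢ (Finset.univ : Finset (Fin n)) : Finset (ℕ × Fin n)) → Bool :=
  fun p => bits r p.1.1 ω p.1.2

/-- The solution as a function of the history. -/
noncomputable def solutionOf (U : CovRule n) (x : Fin n → ℝ) (k : ℕ)
    (h : (Finset.range k ×ˢ (Finset.univ : Finset (Fin n)) : Finset (ℕ × Fin n)) → Bool) :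
    Fin n → ℝ :=
  solution U x (fun i => signs fun j =>
    if hi : i < k then h ⟨(i, j), by simp [hi]⟩ else false) k

theorem IsRandomSigns.solution_eq (hr : IsRandomSigns P r) (U : CovRule n) (x : Fin n → ℝ)
    (k : ℕ) (ω : Ω) :
    solution U x (fun k j => r k j ω) k = solutionOf U x k (history r k ω) := by
  refine solution_congr U x fun i hi => ?_
  rw [← hr.signs_bits i ω]
  congr 1
  ext j
  simp [hi, history]

theorem IsRandomSigns.measurable_bit (hr : IsRandomSigns P r) (k : ℕ) (j : Fin n) :
    Measurable fun ω => bits r k ω j := by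
  refine measurable_to_bool ?_
  have : (fun ω => bits r k ω j) ⁻¹' {true} = r k j ⁻¹' {1} := by
    ext ω; simp [bits]
  rw [this]
  exact hr.measurable k j (measurableSet_singleton 1)

theorem IsRandomSigns.measurable_history (hr : IsRandomSigns P r) (k : ℕ) :
    Measurable (history r k) :=
  measurable_pi_lambda _ fun p => hr.measurable_bit p.1.1 p.1.2

/-- The solution factors through a finite history, so no regularity of `U` or `F` is needed. -/
theorem IsRandomSigns.measurable_comp_solution (hr : IsRandomSigns P r) (U : CovRule n)
    (x : Fin n → ℝ) (k : ℕ) {β : Type*} [MeasurableSpace β] (F : (Fin n → ℝ) → β) :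
    Measurable fun ω => F (solution U x (fun k j => r k j ω) k) := by
  simp only [hr.solution_eq]
  exact (Measurable.of_discrete (f := fun h => F (solutionOf U x k h))).comp
    (hr.measurable_history k)

theorem IsRandomSigns.integrable_comp_solution [IsProbabilityMeasure P]
    (hr : IsRandomSigns P r) (U : CovRule n) (x : Fin n → ℝ) (k : ℕ) (F : (Fin n → ℝ) → ℝ) :
    Integrable (fun ω => F (solution U x (fun k j => r k j ω) k)) P := by
  simp only [hr.solution_eq]
  have : IsProbabilityMeasure (P.map (history r k)) :=
    Measure.isProbabilityMeasure_map (hr.measurable_history k).aemeasurable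
  exact (Integrable.of_finite (f := fun h => F (solutionOf U x k h))).comp_measurable
    (hr.measurable_history k)

theorem IsRandomSigns.iIndepFun_bits (hr : IsRandomSigns P r) :
    iIndepFun (fun (p : ℕ × Fin n) ω => bits r p.1 ω p.2) P := by
  have h := hr.indep.comp (fun _ (y : ℝ) => decide (y = 1)) fun _ => by
    refine measurable_to_bool ?_
    have : (fun y : ℝ => decide (y = 1)) ⁻¹' {true} = {1} := by ext y; simp
    rw [this]
    exact measurableSet_singleton 1
  exact h

theorem IsRandomSigns.measure_bit [IsProbabilityMeasure P] (hr : IsRandomSigns P r) (k : ℕ)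
    (j : Fin n) (b : Bool) : P ((fun ω => bits r k ω j) ⁻¹' {b}) = 1 / 2 := by
  have h1 : (fun ω => bits r k ω j) ⁻¹' {true} = {ω | r k j ω = 1} := by
    ext ω; simp [bits]
  have h2 : (fun ω => bits r k ω j) ⁻¹' {false} = {ω | r k j ω = 1}ᶜ := by
    ext ω; simp [bits]
  cases b with
  | true => rw [h1, hr.prob_one]
  | false =>
    have hm : MeasurableSet {ω | r k j ω = 1} := hr.measurable k j (measurableSet_singleton 1)
    rw [h2, prob_compl_eq_one_sub hm, hr.prob_one]
    norm_num

theorem IsRandomSigns.measure_bits_eq [IsProbabilityMeasure P] (hr : IsRandomSigns P r) (k : ℕ)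
    (ε : Fin n → Bool) : P {ω | bits r k ω = ε} = (1 / 2) ^ n := by
  have h := hr.iIndepFun_bits.measure_inter_preimage_eq_mul
    ({k} ×ˢ (Finset.univ : Finset (Fin n))) (sets := fun p => {ε p.2})
    fun p _ => measurableSet_singleton _
  have h1 : (⋂ p ∈ ({k} ×ˢ (Finset.univ : Finset (Fin n)) : Finset (ℕ × Fin n)),
      (fun ω => bits r p.1 ω p.2) ⁻¹' {ε p.2}) = {ω | bits r k ω = ε} := by
    ext ω
    simp only [Set.mem_iInter, Finset.mem_product, Finset.mem_singleton, Finset.mem_univ,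
      and_true, Set.mem_preimage, Set.mem_singleton_iff, Set.mem_ofPred_eq, funext_iff]
    exact ⟨fun h j => h (k, j) rfl, fun h p hp => by rw [hp]; exact h p.2⟩
  rw [h1] at h
  rw [h, Finset.prod_congr rfl fun p _ => hr.measure_bit p.1 p.2 (ε p.2)]
  simp

theorem IsRandomSigns.indepFun_history (hr : IsRandomSigns P r) (k : ℕ) :
    IndepFun (history r k) (bits r k) P := by
  have h := hr.iIndepFun_bits.indepFun_finset (Finset.range k ×ˢ (Finset.univ : Finset (Fin n)))
    ({k} ×ˢ (Finset.univ : Finset (Fin n))) (by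
      rw [Finset.disjoint_left]
      intro p hp hp'
      simp only [Finset.mem_product, Finset.mem_range, Finset.mem_singleton] at hp hp'
      omega) fun p => hr.measurable_bit p.1 p.2
  exact h.comp measurable_id (measurable_pi_lambda
    (fun (f : ({k} ×ˢ (Finset.univ : Finset (Fin n)) : Finset (ℕ × Fin n)) → Bool) (j : Fin n) =>
      f ⟨(k, j), by simp⟩) fun j => measurable_pi_apply _)

/-- Averaging over the signs of iteration `k`. -/
theorem IsRandomSigns.integral_bits [IsProbabilityMeasure P] (hr : IsRandomSigns P r)
    (U : CovRule n) (x : Fin n → ℝ) (k : ℕ) (F : (Fin n → ℝ) → (Fin n → Bool) → ℝ) :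
    ∫ ω, F (solution U x (fun k j => r k j ω) k) (bits r k ω) ∂P
      = ∫ ω, avg (F (solution U x (fun k j => r k j ω) k)) ∂P := by
  classical
  have hb : Measurable (bits r k) := measurable_pi_lambda _ fun j => hr.measurable_bit k j
  -- Expanding over the `2ⁿ` sign patterns makes each summand a function of the past times an
  -- indicator of the present, which are independent.
  have h1 : ∀ ω, F (solution U x (fun k j => r k j ω) k) (bits r k ω)
      = ∑ ε, F (solutionOf U x k (history r k ω)) ε * (if bits r k ω = ε then 1 else 0) := by
    intro ω
    rw [hr.solution_eq]; simp
  have h2 : ∀ ε, ∫ ω, F (solutionOf U x k (history r k ω)) ε * (if bits r k ω = ε then 1 else 0) ∂P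
      = (∫ ω, F (solutionOf U x k (history r k ω)) ε ∂P) * (2 ^ n)⁻¹ := by
    intro ε
    have hind := (hr.indepFun_history k).comp
      (φ := fun h => F (solutionOf U x k h) ε) (ψ := fun e => if e = ε then (1 : ℝ) else 0)
      Measurable.of_discrete Measurable.of_discrete
    have hm1 : Measurable fun ω => F (solutionOf U x k (history r k ω)) ε :=
      (Measurable.of_discrete (f := fun h => F (solutionOf U x k h) ε)).comp
        (hr.measurable_history k)
    have hm2 : Measurable fun ω => if bits r k ω = ε then (1 : ℝ) else 0 :=
      (Measurable.of_discrete (f := fun e => if e = ε then (1 : ℝ) else 0)).comp hb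
    have h3 := hind.integral_fun_mul_eq_mul_integral hm1.aestronglyMeasurable
      hm2.aestronglyMeasurable
    simp only [Function.comp_apply] at h3
    rw [h3]
    congr 1
    have hset : MeasurableSet {ω | bits r k ω = ε} := hb (measurableSet_singleton ε)
    have h4 : (fun ω => if bits r k ω = ε then (1 : ℝ) else 0)
        = {ω | bits r k ω = ε}.indicator 1 := by
      ext ω; simp [Set.indicator]
    rw [h4, integral_indicator_one hset, Measure.real, hr.measure_bits_eq]
    simp
  simp only [h1]
  rw [integral_finsetSum]
  · simp only [h2, avg, hr.solution_eq]
    rw [integral_const_mul, integral_finsetSum]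
    · rw [← Finset.sum_mul, mul_comm]
    · intro ε _
      have := hr.integrable_comp_solution U x k fun y => F y ε
      simpa only [hr.solution_eq] using this
  · intro ε _
    have h5 := hr.integrable_comp_solution U x k fun y => F y ε
    simp only [hr.solution_eq] at h5
    refine h5.mono ?_ (ae_of_all _ fun ω => ?_)
    · exact h5.aestronglyMeasurable.mul
        ((Measurable.of_discrete (f := fun e => if e = ε then (1 : ℝ) else 0)).comp
          hb).aestronglyMeasurable
    · split_ifs <;> simp

/-- The expectation of a function of the next solution. -/
theorem IsRandomSigns.integral_solution_succ [IsProbabilityMeasure P] (hr : IsRandomSigns P r)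
    (U : CovRule n) (x : Fin n → ℝ) (k : ℕ) (F : (Fin n → ℝ) → ℝ) :
    ∫ ω, F (solution U x (fun k j => r k j ω) (k + 1)) ∂P
      = ∫ ω, avg (fun ε => F (solution U x (fun k j => r k j ω) k
          + step (solution U x (fun k j => r k j ω) k)
            (stepMatrix _ (U k (solution U x (fun k j => r k j ω) k))) ε)) ∂P := by
  rw [← hr.integral_bits U x k fun y ε => F (y + step y (stepMatrix y (U k y)) ε)]
  refine integral_congr_ae (ae_of_all _ fun ω => ?_)
  simp only [solution]
  rw [← update_eq, hr.signs_bits]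

end

/-! ### Running time -/

theorem energy_bounds {n : ℕ} {x : Fin n → ℝ} (hx : x ∈ Set.Icc (0 : Fin n → ℝ) 1) :
    -(1 / 2) ≤ energy x ∧ energy x ≤ n := by
  have h1 : numAlive x / (2 * n) ≤ 1 / 2 := by
    rcases n.eq_zero_or_pos with h0 | hn
    · simp [h0]
    · have : (0 : ℝ) < n := by exact_mod_cast hn
      rw [div_le_div_iff₀ (by positivity) (by norm_num)]
      linarith [numAlive_le x]
  have h2 : 0 ≤ numAlive x / (2 * n) := div_nonneg (numAlive_nonneg x) (by positivity)
  have h3 : 0 ≤ ∑ j, x j ^ 2 := Finset.sum_nonneg fun j _ => sq_nonneg _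
  have h4 : ∑ j, x j ^ 2 ≤ n := by
    refine (Finset.sum_le_sum fun j _ => pow_le_one₀ (n := 2) (hx.1 j) (hx.2 j)).trans_eq ?_
    simp
  unfold energy
  constructor <;> linarith

section

variable {Ω : Type*} [MeasurableSpace Ω] {P : Measure Ω} [IsProbabilityMeasure P] {n : ℕ}
  {r : ℕ → Fin n → Ω → ℝ} {m : ℕ} {A : Matrix (Fin m) (Fin n) ℝ} {t δ : ℝ} {U : CovRule n}
  {x : Fin n → ℝ}

open scoped Classical in
-- The constant `c` is a lower bound for the trace that is uniform over positive alive counts, so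
-- each non-integral time gains `γ² c` in expectation.
theorem IsRandomSigns.integral_energy_succ (hr : IsRandomSigns P r) (hU : U.IsValid A t δ)
    (hx : x ∈ Set.Icc (0 : Fin n → ℝ) 1) {c : ℝ}
    (hc : ∀ N : ℕ, 0 < N → c ≤ slack δ N / 10 * N) (k : ℕ) :
    ∫ ω, energy (solution U x (fun k j => r k j ω) k) ∂P
      + maxStep n ^ 2 * c
        * ∫ ω, (if IsIntegral (solution U x (fun k j => r k j ω) k) then 0 else 1) ∂P
      ≤ ∫ ω, energy (solution U x (fun k j => r k j ω) (k + 1)) ∂P := by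
  rw [hr.integral_solution_succ, ← integral_const_mul, ← integral_add]
  · refine integral_mono ?_ ?_ fun ω => ?_
    · exact hr.integrable_comp_solution U x k fun y => energy y
        + maxStep n ^ 2 * c * (if IsIntegral y then 0 else 1)
    · exact hr.integrable_comp_solution U x k fun y =>
        avg fun ε => energy (y + step y (stepMatrix y (U k y)) ε)
    · have hmem := solution_mem U hx (fun k j => r k j ω) k
      set y := solution U x (fun k j => r k j ω) k with hy
      have h := (hU k y hmem).isStepMatrix.avg_energy_ge hmem
      refine le_trans ?_ h
      dsimp only
      refine add_le_add le_rfl ?_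
      rw [mul_assoc]
      refine mul_le_mul_of_nonneg_left ?_ (sq_nonneg _)
      rcases (Fintype.card (Alive y)).eq_zero_or_pos with h0 | hN
      · rw [if_pos (isIntegral_of_numAlive hmem h0), h0]; simp
      · split_ifs
        -- This branch is contradictory: an integral `y` has no alive variable.
        · have h1 := hU k y hmem
          rw [mul_zero]
          have : 0 ≤ slack δ (Fintype.card (Alive y)) / 10 * Fintype.card (Alive y) := by
            by_contra hneg
            push Not at hneg
            have hs : slack δ (Fintype.card (Alive y)) < 0 := by
              by_contra hs
              push Not at hs
              exact absurd hneg (not_lt.2 (by positivity))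
            unfold slack at hs
            split_ifs at hs with h2
            · exact absurd hs (not_lt.2 (by positivity))
            · have h3 := IsIntegral.not_alive (x := y) ‹_›
              obtain ⟨j⟩ : Nonempty (Alive y) := Fintype.card_pos_iff.1 hN
              exact h3 j j.2
          exact this
        · rw [mul_one]; exact hc _ hN
  · exact hr.integrable_comp_solution U x k energy
  · exact hr.integrable_comp_solution U x k fun y =>
      maxStep n ^ 2 * c * (if IsIntegral y then 0 else 1)

open scoped Classical in
theorem IsRandomSigns.lintegral_tsum_le (hr : IsRandomSigns P r) (hU : U.IsValid A t δ)
    (hx : x ∈ Set.Icc (0 : Fin n → ℝ) 1) {c : ℝ} (hc0 : 0 < c)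
    (hc : ∀ N : ℕ, 0 < N → c ≤ slack δ N / 10 * N) :
    ∫⁻ ω, ∑' k, (if IsIntegral (solution U x (fun k j => r k j ω) k) then 0 else 1) ∂P
      ≤ ENNReal.ofReal (6 * (n : ℝ) ^ 4 / c) := by
  set p : ℕ → ℝ := fun k =>
    ∫ ω, (if IsIntegral (solution U x (fun k j => r k j ω) k) then 0 else 1) ∂P with hp
  have hsum : ∀ K, ∑ k ∈ Finset.range K, p k ≤ 6 * (n : ℝ) ^ 4 / c := by
    intro K
    rcases n.eq_zero_or_pos with h0 | hn
    · subst h0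
      have : ∀ k, p k = 0 := fun k => by
        simp only [hp]
        rw [integral_eq_zero_of_ae]
        exact ae_of_all _ fun ω => if_pos fun j => j.elim0
      simp [this]
    · have hn' : (0 : ℝ) < n := by exact_mod_cast hn
      have hn1 : (1 : ℝ) ≤ n := by exact_mod_cast hn
      have hγ : 0 < maxStep n ^ 2 * c := by
        have := maxStep_pos hn
        positivity
      have h1 : maxStep n ^ 2 * c * ∑ k ∈ Finset.range K, p k
          ≤ ∫ ω, energy (solution U x (fun k j => r k j ω) K) ∂P - energy x := by
        induction K with
        | zero => simp [solution]
        | succ K ih =>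
          rw [Finset.sum_range_succ, mul_add]
          have := hr.integral_energy_succ hU hx hc K
          simp only [hp] at ih ⊢
          linarith
      have h2 : ∫ ω, energy (solution U x (fun k j => r k j ω) K) ∂P ≤ n := by
        have := integral_mono (μ := P) (hr.integrable_comp_solution U x K energy)
          (integrable_const (n : ℝ)) fun ω => (energy_bounds (solution_mem U hx _ K)).2
        simpa using this
      have h3 := (energy_bounds hx).1
      -- The energy has range at most `n + 1/2 ≤ 3 n / 2`; dividing by `γ² c = c / (4 n³)` gives `6
      -- n⁴ / c`.
      have h4 : maxStep n ^ 2 * c * ∑ k ∈ Finset.range K, p k ≤ 3 / 2 * n := by linarith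
      rw [maxStep_sq] at h4
      rw [le_div_iff₀ hc0]
      have e : 1 / (4 * (n : ℝ) ^ 3) * c * ∑ k ∈ Finset.range K, p k
          = ((∑ k ∈ Finset.range K, p k) * c) / (4 * (n : ℝ) ^ 3) := by ring
      rw [e, div_le_iff₀ (by positivity)] at h4
      linarith
  have hp0 : ∀ k, 0 ≤ p k := fun k => integral_nonneg fun ω => by
    dsimp only; split_ifs <;> norm_num
  have hlin : ∀ k, ∫⁻ ω, (if IsIntegral (solution U x (fun k j => r k j ω) k) then 0 else 1) ∂P
      = ENNReal.ofReal (p k) := by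
    intro k
    rw [hp, ofReal_integral_eq_lintegral_ofReal]
    · refine lintegral_congr fun ω => ?_
      split_ifs <;> simp
    · exact hr.integrable_comp_solution U x k fun y => if IsIntegral y then 0 else 1
    · exact ae_of_all _ fun ω => by dsimp only; split_ifs <;> simp
  calc ∫⁻ ω, ∑' k, (if IsIntegral (solution U x (fun k j => r k j ω) k) then 0 else 1) ∂P
      = ∑' k, ENNReal.ofReal (p k) := by
        rw [lintegral_tsum fun k => (hr.measurable_comp_solution U x k
          fun y => if IsIntegral y then (0 : ℝ≥0∞) else 1).aemeasurable]
        simp only [hlin]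
    _ ≤ ENNReal.ofReal (6 * (n : ℝ) ^ 4 / c) := by
        refine ENNReal.tsum_le_of_sum_range_le fun K => ?_
        rw [← ENNReal.ofReal_sum_of_nonneg fun k _ => hp0 k]
        exact ENNReal.ofReal_le_ofReal (hsum K)

theorem IsRandomSigns.lintegral_iterations_le (hr : IsRandomSigns P r) (hU : U.IsValid A t δ)
    (hx : x ∈ Set.Icc (0 : Fin n → ℝ) 1) {c : ℝ} (hc0 : 0 < c)
    (hc : ∀ N : ℕ, 0 < N → c ≤ slack δ N / 10 * N) :
    ∫⁻ ω, (iterations U x (fun k j => r k j ω) : ℝ≥0∞) ∂P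
      ≤ ENNReal.ofReal (6 * (n : ℝ) ^ 4 / c) :=
  (lintegral_mono fun _ => iterations_le_tsum U x _).trans (hr.lintegral_tsum_le hU hx hc0 hc)

theorem IsRandomSigns.ae_iterations_ne_top (hr : IsRandomSigns P r) (hU : U.IsValid A t δ)
    (hx : x ∈ Set.Icc (0 : Fin n → ℝ) 1) {c : ℝ} (hc0 : 0 < c)
    (hc : ∀ N : ℕ, 0 < N → c ≤ slack δ N / 10 * N) :
    ∀ᵐ ω ∂P, iterations U x (fun k j => r k j ω) ≠ ⊤ := by
  classical
  have h := ae_lt_top (Measurable.tsum fun k => hr.measurable_comp_solution U x k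
      fun y => if IsIntegral y then (0 : ℝ≥0∞) else 1)
    ((hr.lintegral_tsum_le hU hx hc0 hc).trans_lt ENNReal.ofReal_lt_top).ne
  filter_upwards [h] with ω hω htop
  have := (iterations_le_tsum U x fun k j => r k j ω).trans_lt hω
  rw [htop] at this
  simp at this

/-! ### Marginals and concentration -/

theorem tendsto_solution (U : CovRule n) (x : Fin n → ℝ) (s : ℕ → Fin n → ℝ)
    (h : iterations U x s ≠ ⊤) {β : Type*} [TopologicalSpace β] (F : (Fin n → ℝ) → β) :
    Filter.Tendsto (fun k => F (solution U x s k)) Filter.atTop (nhds (F (output U x s))) := by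
  obtain ⟨k, hk, hX⟩ := isIntegral_output U x s h
  rw [hX]
  refine tendsto_const_nhds.congr' ?_
  filter_upwards [Filter.eventually_ge_atTop k] with l hl
  rw [solution_eq_of_isIntegral U x s hl hk]

/-- Passing to the limit in expectations of bounded functions of the solution. -/
theorem IsRandomSigns.tendsto_integral (hr : IsRandomSigns P r) (U : CovRule n)
    (hx : x ∈ Set.Icc (0 : Fin n → ℝ) 1)
    (hT : ∀ᵐ ω ∂P, iterations U x (fun k j => r k j ω) ≠ ⊤) (F : (Fin n → ℝ) → ℝ) {M : ℝ}
    (hF : ∀ y ∈ Set.Icc (0 : Fin n → ℝ) 1, |F y| ≤ M) :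
    Integrable (fun ω => F (output U x fun k j => r k j ω)) P ∧
    Filter.Tendsto (fun k => ∫ ω, F (solution U x (fun k j => r k j ω) k) ∂P) Filter.atTop
      (nhds (∫ ω, F (output U x fun k j => r k j ω) ∂P)) := by
  have hlim : ∀ᵐ ω ∂P, Filter.Tendsto (fun k => F (solution U x (fun k j => r k j ω) k))
      Filter.atTop (nhds (F (output U x fun k j => r k j ω))) := by
    filter_upwards [hT] with ω h using tendsto_solution U x _ h F
  have hmeas := fun k => (hr.integrable_comp_solution U x k F).aestronglyMeasurable
  refine ⟨?_, tendsto_integral_of_dominated_convergence (fun _ => M) hmeas (integrable_const M)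
    (fun k => ae_of_all _ fun ω => hF _ (solution_mem U hx _ k)) hlim⟩
  refine (integrable_const M).mono (aestronglyMeasurable_of_tendsto_ae _ hmeas hlim) ?_
  filter_upwards [hT] with ω h
  obtain ⟨k, -, hX⟩ := isIntegral_output U x _ h
  rw [hX]
  exact (hF _ (solution_mem U hx _ k)).trans (le_abs_self M)

theorem IsRandomSigns.integral_solution_apply (hr : IsRandomSigns P r) (U : CovRule n)
    (x : Fin n → ℝ) (k : ℕ) (j : Fin n) :
    ∫ ω, solution U x (fun k j => r k j ω) k j ∂P = x j := by
  induction k with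
  | zero => simp [solution]
  | succ k ih =>
    rw [hr.integral_solution_succ U x k fun y => y j]
    rw [← ih]
    refine integral_congr_ae (ae_of_all _ fun ω => ?_)
    set y := solution U x (fun k j => r k j ω) k
    have h := avg_dotProduct_step y (stepMatrix y (U k y)) (Pi.single j 1)
    simp only [single_dotProduct, one_mul] at h
    simp only [Pi.add_apply]
    rw [avg_add, avg_const, h, add_zero]

theorem IsRandomSigns.integral_output_apply (hr : IsRandomSigns P r) (U : CovRule n)
    (hx : x ∈ Set.Icc (0 : Fin n → ℝ) 1)
    (hT : ∀ᵐ ω ∂P, iterations U x (fun k j => r k j ω) ≠ ⊤) (j : Fin n) :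
    Integrable (fun ω => output U x (fun k j => r k j ω) j) P ∧
      ∫ ω, output U x (fun k j => r k j ω) j ∂P = x j := by
  have h := hr.tendsto_integral U hx hT (fun y => y j) (M := 1) fun y hy => by
    rw [abs_of_nonneg (hy.1 j)]; exact hy.2 j
  refine ⟨h.1, tendsto_nhds_unique h.2 ?_⟩
  simp only [hr.integral_solution_apply]
  exact tendsto_const_nhds

theorem IsRandomSigns.integral_exp_solution_le (hr : IsRandomSigns P r) (hU : U.IsValid A t δ)
    (hx : x ∈ Set.Icc (0 : Fin n → ℝ) 1) (hδ : 0 < δ) (hδ1 : δ < 1) (o : Fin n → Bool)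
    (a : Fin n → ℝ) {l : ℝ} (hl : 0 ≤ l) (hla : l * (15360 / δ) * ‖a‖ ≤ 1 / 2) (k : ℕ) :
    ∫ ω, Real.exp (l * (a ⬝ᵥ solution U x (fun k j => r k j ω) k)
        + l ^ 2 * (15360 / δ) * potential o a (solution U x (fun k j => r k j ω) k)) ∂P
      ≤ Real.exp (l * (a ⬝ᵥ x) + l ^ 2 * (15360 / δ) * potential o a x) := by
  induction k with
  | zero => simp [solution]
  | succ k ih =>
    refine le_trans ?_ ih
    rw [hr.integral_solution_succ U x k fun y =>
      Real.exp (l * (a ⬝ᵥ y) + l ^ 2 * (15360 / δ) * potential o a y)]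
    refine integral_mono ?_ ?_ fun ω => ?_
    · exact hr.integrable_comp_solution U x k fun y => avg fun ε =>
        Real.exp (l * (a ⬝ᵥ (y + step y (stepMatrix y (U k y)) ε))
          + l ^ 2 * (15360 / δ) * potential o a (y + step y (stepMatrix y (U k y)) ε))
    · exact hr.integrable_comp_solution U x k fun y =>
        Real.exp (l * (a ⬝ᵥ y) + l ^ 2 * (15360 / δ) * potential o a y)
    · have hmem := solution_mem U hx (fun k j => r k j ω) k
      set y := solution U x (fun k j => r k j ω) k
      have hs : slack δ (Fintype.card (Alive y)) = δ := if_neg hδ.ne'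
      have h1 := (hU k y hmem).isStepMatrix
      rw [hs] at h1
      -- The rule has `η = 10 / (9 δ)`, hence `13824 η = 15360 / δ`.
      have e : 15360 / δ = 13824 * (10 / (9 * δ)) := by field_simp; norm_num
      rw [e] at hla ⊢
      refine h1.avg_exp_le hmem ?_ o a hl hla
      rw [le_div_iff₀ (by positivity)]
      linarith

/-- Orienting each variable towards its nearer end at the start gives `min(x, 1 - x) ≤ 2 (x - x²)`,
and the reserve lies below this. The orientation stays fixed throughout the run. -/
theorem potential_le {x : Fin n → ℝ} (hx : x ∈ Set.Icc (0 : Fin n → ℝ) 1) (a : Fin n → ℝ) :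
    potential (fun j => decide (x j ≤ 1 / 2)) a x ≤ 3 * ∑ j, a j ^ 2 * (x j - x j ^ 2) := by
  rw [Finset.mul_sum]
  refine Finset.sum_le_sum fun j _ => ?_
  rw [mul_left_comm]
  refine mul_le_mul_of_nonneg_left ?_ (sq_nonneg _)
  have h1 := reserve_le_oriented (fun j => decide (x j ≤ 1 / 2)) hx j
  have h2 : 0 ≤ x j := hx.1 j
  have h3 : x j ≤ 1 := hx.2 j
  have h4 : oriented (fun j => decide (x j ≤ 1 / 2)) x j ≤ 2 * (x j - x j ^ 2) := by
    unfold oriented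
    by_cases h : x j ≤ 1 / 2
    · simp only [h, decide_true, if_true]; nlinarith
    · simp only [h, decide_false]
      push Not at h
      simp only [Bool.false_eq_true, if_false]
      nlinarith
  linarith

theorem IsRandomSigns.isConcentrated_output (hr : IsRandomSigns P r) (hU : U.IsValid A t δ)
    (hx : x ∈ Set.Icc (0 : Fin n → ℝ) 1) (hδ : 0 < δ) (hδ1 : δ < 1)
    (hT : ∀ᵐ ω ∂P, iterations U x (fun k j => r k j ω) ≠ ⊤) :
    IsConcentrated P (92160 / δ) fun ω => output U x fun k j => r k j ω := by
  refine ⟨by rw [le_div_iff₀ hδ]; linarith, fun a s hs => ?_⟩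
  have hmean := fun j => hr.integral_output_apply U hx hT j
  simp only [fun j => (hmean j).2]
  have hmeana : ∫ ω, a ⬝ᵥ output U x (fun k j => r k j ω) ∂P = a ⬝ᵥ x := by
    simp only [dotProduct]
    rw [integral_finsetSum _ fun j _ => (hmean j).1.const_mul _]
    simp only [integral_const_mul, fun j => (hmean j).2]
  rw [hmeana]
  set Q := ∑ j, a j ^ 2 * (x j - x j ^ 2) with hQ
  have hQ0 : 0 ≤ Q := Finset.sum_nonneg fun j _ => mul_nonneg (sq_nonneg _) (by
    have h2 : 0 ≤ x j := hx.1 j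
    have h3 : x j ≤ 1 := hx.2 j
    nlinarith)
  have hM : 0 ≤ ‖a‖ * s := by positivity
  -- With zero denominator, division by zero makes the exponent `0` and the bound `1`.
  rcases (add_nonneg hQ0 (div_nonneg hM (by norm_num : (0 : ℝ) ≤ 3))).eq_or_lt with h0 | hpos
  · rw [← h0]
    simp
  set κ := 15360 / δ with hκ
  have hκ0 : 0 < κ := by positivity
  have hden : 0 < 6 * κ * (Q + ‖a‖ * s / 3) := by positivity
  -- This minimises `-l s + 3 l² κ (Q + ‖a‖ s / 3)`; the second summand keeps `l` small enough for
  -- the supermartingale.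
  set l := s / (6 * κ * (Q + ‖a‖ * s / 3)) with hl
  have hl0 : 0 ≤ l := div_nonneg hs hden.le
  have hls : l * (6 * κ * (Q + ‖a‖ * s / 3)) = s := div_mul_cancel₀ s hden.ne'
  have hla : l * κ * ‖a‖ ≤ 1 / 2 := by
    rw [hl, div_mul_eq_mul_div, div_mul_eq_mul_div, div_le_iff₀ hden]
    nlinarith [mul_nonneg hκ0.le hQ0]
  set o : Fin n → Bool := fun j => decide (x j ≤ 1 / 2) with ho
  have hbound : ∀ y ∈ Set.Icc (0 : Fin n → ℝ) 1, |a ⬝ᵥ y| ≤ ∑ j, |a j| := by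
    intro y hy
    refine (Finset.abs_sum_le_sum_abs _ _).trans (Finset.sum_le_sum fun j _ => ?_)
    rw [abs_mul, abs_of_nonneg (hy.1 j)]
    exact mul_le_of_le_one_right (abs_nonneg _) (hy.2 j)
  have hlim := hr.tendsto_integral U hx hT (fun y => Real.exp (l * (a ⬝ᵥ y - a ⬝ᵥ x)))
    (M := Real.exp (l * (∑ j, |a j| - a ⬝ᵥ x))) fun y hy => by
      rw [abs_of_pos (Real.exp_pos _), Real.exp_le_exp]
      exact mul_le_mul_of_nonneg_left
        (sub_le_sub_right ((le_abs_self _).trans (hbound y hy)) _) hl0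
  have hmgf : ∫ ω, Real.exp (l * (a ⬝ᵥ output U x (fun k j => r k j ω) - a ⬝ᵥ x)) ∂P
      ≤ Real.exp (l ^ 2 * κ * (3 * Q)) := by
    refine le_of_tendsto hlim.2 (Filter.Eventually.of_forall fun k => ?_)
    have h1 := hr.integral_exp_solution_le hU hx hδ hδ1 o a hl0 hla k
    rw [← hκ] at h1
    have h2 : ∫ ω, Real.exp (l * (a ⬝ᵥ solution U x (fun k j => r k j ω) k - a ⬝ᵥ x)) ∂P
        ≤ Real.exp (-(l * (a ⬝ᵥ x))) *
          ∫ ω, Real.exp (l * (a ⬝ᵥ solution U x (fun k j => r k j ω) k)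
            + l ^ 2 * κ * potential o a (solution U x (fun k j => r k j ω) k)) ∂P := by
      rw [← integral_const_mul]
      refine integral_mono ?_ ?_ fun ω => ?_
      · exact hr.integrable_comp_solution U x k fun y => Real.exp (l * (a ⬝ᵥ y - a ⬝ᵥ x))
      · exact hr.integrable_comp_solution U x k fun y => Real.exp (-(l * (a ⬝ᵥ x))) *
          Real.exp (l * (a ⬝ᵥ y) + l ^ 2 * κ * potential o a y)
      · dsimp only
        rw [← Real.exp_add, Real.exp_le_exp]
        have := potential_nonneg o (solution_mem U hx (fun k j => r k j ω) k) a
        have : 0 ≤ l ^ 2 * κ * potential o a (solution U x (fun k j => r k j ω) k) := by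
          positivity
        linarith
    refine h2.trans ((mul_le_mul_of_nonneg_left h1 (Real.exp_pos _).le).trans ?_)
    rw [← Real.exp_add, Real.exp_le_exp]
    have h3 := mul_le_mul_of_nonneg_left (potential_le hx a)
      (show 0 ≤ l ^ 2 * κ by positivity)
    linarith
  have hch := measure_ge_le_exp_mul_mgf (μ := P)
    (X := fun ω => a ⬝ᵥ output U x (fun k j => r k j ω) - a ⬝ᵥ x) s hl0 hlim.1
  refine hch.trans ((mul_le_mul_of_nonneg_left hmgf (Real.exp_pos _).le).trans ?_)
  rw [← Real.exp_add, Real.exp_le_exp]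
  -- Chernoff's exponent `-l s + 3 l² κ Q` is at most `-l s / 2`, and `92160 = 6 · 15360`.
  have e1 : -(s ^ 2 / (92160 / δ)) / (2 * (Q + ‖a‖ * s / 3)) = -(l * s / 2) := by
    have : 92160 / δ = 6 * κ := by rw [hκ]; ring
    rw [this, hl]
    field_simp
  rw [e1]
  have h5 : l * (6 * κ * Q) ≤ s := by
    refine le_trans ?_ hls.le
    refine mul_le_mul_of_nonneg_left (mul_le_mul_of_nonneg_left ?_ (by positivity)) hl0
    linarith [div_nonneg hM (by norm_num : (0 : ℝ) ≤ 3)]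
  nlinarith [mul_le_mul_of_nonneg_left h5 hl0]

end

end SubIsotropic

/-! ### Assembly of the guarantees -/

theorem mainTheorem2 :
    ∃ C : ℝ, 0 < C ∧
      ∀ (m n : ℕ) (A : Matrix (Fin m) (Fin n) ℝ) (t δ : ℝ),
        0 ≤ t → (∀ j, ∑ i, |A i j| ≤ t) → 0 ≤ δ → δ < 1 →
        -- each iteration can be carried out
        (∃ U : SubIsotropic.CovRule n, U.IsValid A t δ) ∧
        -- and, whichever feasible matrices are selected, the algorithm has the stated guarantees
        ∀ U : SubIsotropic.CovRule n, U.IsValid A t δ →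
          ∀ x : Fin n → ℝ, x ∈ Set.Icc 0 1 →
            ∀ (Ω : Type*) [MeasurableSpace Ω] (P : Measure Ω) [IsProbabilityMeasure P]
              (r : ℕ → Fin n → Ω → ℝ), SubIsotropic.IsRandomSigns P r →
              ∀ (T : Ω → ℕ∞) (X : Ω → Fin n → ℝ),
                (T = fun ω => SubIsotropic.iterations U x (fun k j => r k j ω)) →
                (X = fun ω => SubIsotropic.output U x (fun k j => r k j ω)) →
                -- termination and the expected number of iterations
                (∀ᵐ ω ∂P, T ω ≠ ⊤) ∧
                (δ = 0 → ∫⁻ ω, (T ω : ℝ≥0∞) ∂P ≤ ENNReal.ofReal (C * (n : ℝ) ^ 4)) ∧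
                (0 < δ → ∫⁻ ω, (T ω : ℝ≥0∞) ∂P ≤ ENNReal.ofReal (C * (n : ℝ) ^ 4 / δ)) ∧
                -- the returned vector is integral, and the error bound holds with probability one
                (∀ᵐ ω ∂P, (∀ j, X ω j = 0 ∨ X ω j = 1) ∧
                  ∀ i, |(A *ᵥ (X ω - x)) i| ≤ t / (1 - δ)) ∧
                -- the marginals are preserved
                (∀ j, Integrable (fun ω => X ω j) P ∧ ∫ ω, X ω j ∂P = x j) ∧
                -- concentration
                (0 < δ → SubIsotropic.IsConcentrated P (C / δ) X) := by
  -- Concentration dictates the constant; the running time needs only `6 · 10 = 60`.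
  refine ⟨92160, by norm_num, fun m n A t δ ht hA hδ hδ1 => ⟨SubIsotropic.exists_isValid hA hδ hδ1,
    fun U hU x hx Ω _ P _ r hr T X hT hX => ?_⟩⟩
  subst hT hX
  have hn4 : (0 : ℝ) ≤ (n : ℝ) ^ 4 := by positivity
  have key : ∀ c : ℝ, 0 < c → (∀ N : ℕ, 0 < N → c ≤ SubIsotropic.slack δ N / 10 * N) →
      (∫⁻ ω, (SubIsotropic.iterations U x (fun k j => r k j ω) : ℝ≥0∞) ∂P
        ≤ ENNReal.ofReal (6 * (n : ℝ) ^ 4 / c)) ∧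
      ∀ᵐ ω ∂P, SubIsotropic.iterations U x (fun k j => r k j ω) ≠ ⊤ :=
    fun c hc0 hc => ⟨hr.lintegral_iterations_le hU hx hc0 hc,
      hr.ae_iterations_ne_top hU hx hc0 hc⟩
  have hzero : δ = 0 → ∀ N : ℕ, 0 < N → (1 / 10 : ℝ) ≤ SubIsotropic.slack δ N / 10 * N := by
    intro h N hN
    have : (0 : ℝ) < N := by exact_mod_cast hN
    rw [SubIsotropic.slack, if_pos h]
    field_simp
    norm_num
  have hposi : 0 < δ → ∀ N : ℕ, 0 < N → δ / 10 ≤ SubIsotropic.slack δ N / 10 * N := by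
    intro h N hN
    have : (1 : ℝ) ≤ N := by exact_mod_cast hN
    rw [SubIsotropic.slack, if_neg h.ne']
    nlinarith
  have hT : ∀ᵐ ω ∂P, SubIsotropic.iterations U x (fun k j => r k j ω) ≠ ⊤ := by
    rcases hδ.eq_or_lt with h | h
    · exact (key _ (by norm_num) (hzero h.symm)).2
    · exact (key _ (by positivity) (hposi h)).2
  refine ⟨hT, fun h => ?_, fun h => ?_, ?_, fun j => hr.integral_output_apply U hx hT j,
    fun h => hr.isConcentrated_output hU hx h hδ1 hT⟩
  · refine (key _ (by norm_num) (hzero h)).1.trans (ENNReal.ofReal_le_ofReal ?_)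
    linarith
  · refine (key _ (by positivity) (hposi h)).1.trans (ENNReal.ofReal_le_ofReal ?_)
    rw [div_le_div_iff₀ (by positivity) h]
    nlinarith [mul_nonneg hn4 h.le]
  · filter_upwards [hT] with ω h
    obtain ⟨k, hk, hXk⟩ := SubIsotropic.isIntegral_output U x _ h
    rw [hXk]
    exact ⟨hk, SubIsotropic.abs_row_error_le ht hδ1 hU hx _ hk⟩
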